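/- **Setting.** For integers $d\ge 1$ and $n_0,n_1,\dots,n_d,m\ge 1$, write $k=n_0$, $n=n_d$. Let $W_i\in\mathbb R^{n_i\times n_{i-1}}$ $(i=1,\dots,d)$ and $A\in\mathbb R^{m\times n}$, and let $G:\mathbb R^k\to\mathbb R^n$, $G(x)=\mathrm{relu}(W_d\cdots\mathrm{relu}(W_2\,\mathrm{relu}(W_1x))\cdots)$, where $\mathrm{relu}(t)=\max(t,0)$ acts entrywise. A matrix $W\in\mathbb R^{p\times q}$ with rows $w_1,\dots,w_p$ satisfies the *Weight Distribution Condition* (WDC) with constant $\epsilon$ if for all nonzero $x,y\in\mathbb R^q$, in spectral norm, $$\Bigl\|\sum_{i=1}^p 1_{w_i\cdot x>0}\,1_{w_i\cdot y>0}\,w_iw_i^t-Q_{x,y}\Bigr\|\le\epsilon,\qquad Q_{x,y}=\frac{\pi-\theta}{2\pi}I_q+\frac{\sin\theta}{2\pi}M_{\hat x\leftrightarrow\hat y},$$ where $\theta=\angle(x,y)$, $\hat x=x/\|x\|_2$, $\hat y=y/\|y\|_2$, and $M_{\hat x\leftrightarrow\hat y}$ is the matrix with $\hat x\mapsto\hat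 y$, $\hat y\mapsto\hat x$ and $z\mapsto 0$ for all $z\in\mathrm{span}(\{x,y\})^\perp$. The matrix $A$ satisfies the *Range Restricted Isometry Condition* (RRIC) with respect to $G$ with constant $\epsilon$ if for all $x_1,x_2,x_3,x_4\in\mathbb R^k$, $$\bigl|\langle A(G(x_1)-G(x_2)),A(G(x_3)-G(x_4))\rangle-\langle G(x_1)-G(x_2),G(x_3)-G(x_4)\rangle\bigr|\le\epsilon\,\|G(x_1)-G(x_2)\|_2\,\|G(x_3)-G(x_4)\|_2 .$$ **Proposition.** There exist a universal constant $\tilde c>0$ and functions $c,\gamma:(0,1)\to(0,\infty)$ such that $c(\epsilon)$ and $\gamma(\epsilon)^{-1}$ depend polynomially on $\epsilon^{-1}$ (each is at most $C\epsilon^{-p}$ on $(0,1)$ for some $C>0$ and some positive integer $p$), with the following property. Fix $0<\epsilon<1$ and put $c=c(\epsilon)$, $\gamma=\gamma(\epsilon)$. Let $d,n_0=k,n_1,\dots,n_d,m$ be positive integers with $n_i\ge c\,n_{i-1}\log n_{i-1}$ for all $i=1,\dots,d$ and $m>c\,d\,k\log\prod_{i=1}^d n_i$. Suppose that for each $i$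 the entries of $W_i$ are i.i.d. $\mathcal N(0,1/n_i)$ (no independence between different $W_i$ is assumed), and that the entries of $A$ are i.i.d. $\mathcal N(0,1/m)$ and $A$ is independent of $(W_1,\dots,W_d)$. Then, on an event of probability at least $$1-\sum_{i=1}^d\tilde c\,n_i e^{-\gamma n_{i-1}}-\tilde c\,e^{-\gamma m},$$ $W_i$ satisfies the WDC with constant $\epsilon$ for every $i=1,\dots,d$, and $A$ satisfies the RRIC with respect to $G$ with constant $\epsilon$. -/

import Mathlib

open MeasureTheory ProbabilityTheory
open scoped NNReal Matrix

noncomputable section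

/-- The normalization `x̂ = x / ‖x‖` of a vector (with Euclidean norm). -/
def normalized {k : ℕ} (x : EuclideanSpace ℝ (Fin k)) : EuclideanSpace ℝ (Fin k) :=
  ‖x‖⁻¹ • x

/-- The rank-one matrix `u uᵗ / ‖u‖²`, i.e. the orthogonal projection onto the line through `u`
(and the zero matrix when `u = 0`). -/
def lineProj {k : ℕ} (u : EuclideanSpace ℝ (Fin k)) : Matrix (Fin k) (Fin k) ℝ :=
  (‖u‖ ^ 2)⁻¹ • Matrix.vecMulVec u.ofLp u.ofLp

/-- The matrix `M_{x̂ ↔ ŷ}`: the unique matrix with `x̂ ↦ ŷ`, `ŷ ↦ x̂` and `z ↦ 0` for every `z`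
orthogonal to `x` and `y`. It fixes `x̂ + ŷ`, negates `x̂ - ŷ` (these two are orthogonal) and kills
their orthogonal complement, which gives the formula used here. The three characterizing properties
are `swapMatrix_mulVec_left`, `swapMatrix_mulVec_right` and `swapMatrix_mulVec_orthogonal`, and
uniqueness is `eq_swapMatrix`. -/
def swapMatrix {k : ℕ} (x y : EuclideanSpace ℝ (Fin k)) : Matrix (Fin k) (Fin k) ℝ :=
  lineProj (normalized x + normalized y) - lineProj (normalized x - normalized y)

theorem norm_normalized {k : ℕ} {x : EuclideanSpace ℝ (Fin k)} (hx : x ≠ 0) :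
    ‖normalized x‖ = 1 := by
  have : ‖x‖ ≠ 0 := norm_ne_zero_iff.mpr hx
  simp [normalized, norm_smul, this]

theorem lineProj_mulVec {k : ℕ} (u z : EuclideanSpace ℝ (Fin k)) :
    WithLp.toLp 2 (lineProj u *ᵥ z.ofLp) = ((‖u‖ ^ 2)⁻¹ * inner ℝ u z) • u := by
  ext i
  simp [lineProj, Matrix.smul_mulVec, Matrix.vecMulVec_mulVec, EuclideanSpace.inner_eq_star_dotProduct,
    dotProduct_comm]
  ring

theorem swapMatrix_mulVec {k : ℕ} (x y z : EuclideanSpace ℝ (Fin k)) :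
    WithLp.toLp 2 (swapMatrix x y *ᵥ z.ofLp) =
      ((‖normalized x + normalized y‖ ^ 2)⁻¹ * inner ℝ (normalized x + normalized y) z) •
          (normalized x + normalized y) -
        ((‖normalized x - normalized y‖ ^ 2)⁻¹ * inner ℝ (normalized x - normalized y) z) •
          (normalized x - normalized y) := by
  rw [← lineProj_mulVec, ← lineProj_mulVec, swapMatrix, Matrix.sub_mulVec, WithLp.toLp_sub]

theorem half_coeff {k : ℕ} {u v : EuclideanSpace ℝ (Fin k)} (hu : ‖u‖ = 1) (hv : ‖v‖ = 1) :
    ((‖u + v‖ ^ 2)⁻¹ * inner ℝ (u + v) u) • (u + v) = (1 / 2 : ℝ) • (u + v) := by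
  by_cases h : u + v = 0
  · simp [h]
  · have h1 : ‖u + v‖ ^ 2 ≠ 0 := pow_ne_zero _ (norm_ne_zero_iff.mpr h)
    have h2 : inner ℝ (u + v) u = (1 / 2 : ℝ) * ‖u + v‖ ^ 2 := by
      rw [norm_add_sq_real, inner_add_left, real_inner_self_eq_norm_sq, hu, hv,
        real_inner_comm u v]
      ring
    rw [h2]
    congr 1
    field_simp

theorem swapMatrix_mulVec_left {k : ℕ} {x y : EuclideanSpace ℝ (Fin k)} (hx : x ≠ 0)
    (hy : y ≠ 0) :
    WithLp.toLp 2 (swapMatrix x y *ᵥ (normalized x).ofLp) = normalized y := by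
  have hu := norm_normalized hx
  have hv := norm_normalized hy
  have hv' : ‖-normalized y‖ = 1 := by rw [norm_neg, hv]
  have h2 := half_coeff hu hv'
  rw [← sub_eq_add_neg] at h2
  rw [swapMatrix_mulVec, half_coeff hu hv, h2]
  module

theorem swapMatrix_mulVec_right {k : ℕ} {x y : EuclideanSpace ℝ (Fin k)} (hx : x ≠ 0)
    (hy : y ≠ 0) :
    WithLp.toLp 2 (swapMatrix x y *ᵥ (normalized y).ofLp) = normalized x := by
  have h : swapMatrix x y = swapMatrix y x := by
    have h1 : ∀ u : EuclideanSpace ℝ (Fin k), lineProj (-u) = lineProj u := by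
      intro u
      simp [lineProj]
    rw [swapMatrix, swapMatrix, add_comm, ← h1 (normalized x - normalized y), neg_sub]
  rw [h]
  exact swapMatrix_mulVec_left hy hx

theorem swapMatrix_mulVec_orthogonal {k : ℕ} {x y z : EuclideanSpace ℝ (Fin k)}
    (hxz : inner ℝ x z = 0) (hyz : inner ℝ y z = 0) :
    WithLp.toLp 2 (swapMatrix x y *ᵥ z.ofLp) = 0 := by
  rw [swapMatrix_mulVec]
  simp [normalized, inner_add_left, inner_sub_left, real_inner_smul_left, hxz, hyz]

theorem eq_swapMatrix {k : ℕ} {x y : EuclideanSpace ℝ (Fin k)} (hx : x ≠ 0) (hy : y ≠ 0)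
    (M : Matrix (Fin k) (Fin k) ℝ)
    (h1 : WithLp.toLp 2 (M *ᵥ (normalized x).ofLp) = normalized y)
    (h2 : WithLp.toLp 2 (M *ᵥ (normalized y).ofLp) = normalized x)
    (h3 : ∀ z : EuclideanSpace ℝ (Fin k), inner ℝ x z = 0 → inner ℝ y z = 0 →
      WithLp.toLp 2 (M *ᵥ z.ofLp) = 0) : M = swapMatrix x y := by
  set D := Matrix.toEuclideanLin (M - swapMatrix x y) with hD
  have key : ∀ z, D z = WithLp.toLp 2 (M *ᵥ z.ofLp) -
      WithLp.toLp 2 (swapMatrix x y *ᵥ z.ofLp) := by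
    intro z
    rw [← WithLp.toLp_sub, ← Matrix.sub_mulVec]
    rfl
  have scale : ∀ u : EuclideanSpace ℝ (Fin k), u ≠ 0 → D (normalized u) = 0 → D u = 0 := by
    intro u hu h
    have : ‖u‖⁻¹ ≠ 0 := inv_ne_zero (norm_ne_zero_iff.mpr hu)
    simpa [normalized, this] using h
  have hDx : D x = 0 := scale x hx (by rw [key, h1, swapMatrix_mulVec_left hx hy, sub_self])
  have hDy : D y = 0 := scale y hy (by rw [key, h2, swapMatrix_mulVec_right hx hy, sub_self])
  have hspan : Submodule.span ℝ {x, y} ≤ LinearMap.ker D := by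
    rw [Submodule.span_le]
    rintro z (rfl | rfl)
    · exact hDx
    · exact hDy
  have hD0 : D = 0 := by
    ext1 z
    obtain ⟨a, ha, b, hb, rfl⟩ := (Submodule.span ℝ {x, y}).exists_add_mem_mem_orthogonal z
    have hbx : inner ℝ x b = 0 := hb x (Submodule.subset_span (by simp))
    have hby : inner ℝ y b = 0 := hb y (Submodule.subset_span (by simp))
    rw [map_add, LinearMap.mem_ker.mp (hspan ha), key b, h3 b hbx hby,
      swapMatrix_mulVec_orthogonal hbx hby]
    simp
  have : M - swapMatrix x y = 0 := by
    apply Matrix.toEuclideanLin.injective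
    rw [← hD, hD0, map_zero]
  exact sub_eq_zero.mp this

/-- `Q_{x,y} = (π - θ)/(2π) I + (sin θ)/(2π) M_{x̂ ↔ ŷ}`, where `θ = ∠(x, y)`. -/
def Qmat {k : ℕ} (x y : EuclideanSpace ℝ (Fin k)) : Matrix (Fin k) (Fin k) ℝ :=
  ((Real.pi - InnerProductGeometry.angle x y) / (2 * Real.pi)) • (1 : Matrix (Fin k) (Fin k) ℝ) +
    (Real.sin (InnerProductGeometry.angle x y) / (2 * Real.pi)) • swapMatrix x y

/-- `∑ᵢ 1_{wᵢ·x > 0} 1_{wᵢ·y > 0} wᵢ wᵢᵗ`, where `wᵢ` is the `i`-th row of `W`. -/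
def activeGram {n k : ℕ} (W : Matrix (Fin n) (Fin k) ℝ) (x y : EuclideanSpace ℝ (Fin k)) :
    Matrix (Fin k) (Fin k) ℝ :=
  ∑ i, if 0 < W i ⬝ᵥ x.ofLp ∧ 0 < W i ⬝ᵥ y.ofLp then Matrix.vecMulVec (W i) (W i) else 0

/-- The Weight Distribution Condition with constant `ε`. The norm is the spectral norm. -/
def WDC {n k : ℕ} (W : Matrix (Fin n) (Fin k) ℝ) (ε : ℝ) : Prop :=
  ∀ x y : EuclideanSpace ℝ (Fin k), x ≠ 0 → y ≠ 0 →
    ‖Matrix.toEuclideanCLM (𝕜 := ℝ) (activeGram W x y - Qmat x y)‖ ≤ ε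

/-- The action of a matrix on Euclidean vectors. -/
def act {m n : ℕ} (A : Matrix (Fin m) (Fin n) ℝ) (u : EuclideanSpace ℝ (Fin n)) :
    EuclideanSpace ℝ (Fin m) :=
  WithLp.toLp 2 (A *ᵥ u.ofLp)

/-- The Range Restricted Isometry Condition of `A` with respect to `G` with constant `ε`. -/
def RRIC {m n k : ℕ} (A : Matrix (Fin m) (Fin n) ℝ)
    (G : EuclideanSpace ℝ (Fin k) → EuclideanSpace ℝ (Fin n)) (ε : ℝ) : Prop :=
  ∀ x₁ x₂ x₃ x₄ : EuclideanSpace ℝ (Fin k),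
    |inner ℝ (act A (G x₁ - G x₂)) (act A (G x₃ - G x₄)) - inner ℝ (G x₁ - G x₂) (G x₃ - G x₄)| ≤
      ε * ‖G x₁ - G x₂‖ * ‖G x₃ - G x₄‖

/-- The entrywise rectified linear unit. -/
def relu {n : ℕ} (u : EuclideanSpace ℝ (Fin n)) : EuclideanSpace ℝ (Fin n) :=
  WithLp.toLp 2 fun i => max (u i) 0

/-- The output of the first `i` layers (`0 ≤ i ≤ d`) of the network with weights `W` on input `x`.
The layer with index `i : Fin d` maps dimension `n i.castSucc` to dimension `n i.succ`, so that
`W i` is the `(i + 1)`-st weight matrix in the usual numbering `1, …, d`. -/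
def layerOutput {d : ℕ} {n : Fin (d + 1) → ℕ}
    (W : (i : Fin d) → Matrix (Fin (n i.succ)) (Fin (n i.castSucc)) ℝ)
    (x : EuclideanSpace ℝ (Fin (n 0))) (i : Fin (d + 1)) : EuclideanSpace ℝ (Fin (n i)) :=
  Fin.induction (motive := fun i => EuclideanSpace ℝ (Fin (n i))) x
    (fun i h => relu (act (W i) h)) i

/-- The generative network `G(x) = relu(W_d ⋯ relu(W_2 relu(W_1 x)) ⋯ )`. -/
def network {d : ℕ} {n : Fin (d + 1) → ℕ}
    (W : (i : Fin d) → Matrix (Fin (n i.succ)) (Fin (n i.castSucc)) ℝ)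
    (x : EuclideanSpace ℝ (Fin (n 0))) : EuclideanSpace ℝ (Fin (n (Fin.last d))) :=
  layerOutput W x (Fin.last d)

/-- The entries of the random matrix `X` are i.i.d. `N(0, v)` (`v` is the variance). -/
def IIDGaussianEntries {Ω : Type*} [MeasurableSpace Ω] {m n : ℕ}
    (X : Ω → Matrix (Fin m) (Fin n) ℝ) (v : ℝ≥0) (μ : Measure Ω) : Prop :=
  iIndepFun (fun (p : Fin m × Fin n) (ω : Ω) => X ω p.1 p.2) μ ∧
    ∀ i j, HasLaw (fun ω => X ω i j) (gaussianReal 0 v) μ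

/-- `f`, a function of `ε ∈ (0, 1)`, depends polynomially on `ε⁻¹`: it is at most `C ε^{-p}` for
some positive `C` and some positive integer `p`. -/
def PolyInInv (f : ℝ → ℝ) : Prop :=
  ∃ (C : ℝ) (p : ℕ), 0 < C ∧ 0 < p ∧ ∀ ε : ℝ, 0 < ε → ε < 1 → f ε ≤ C * (ε⁻¹) ^ p

end

/-! ### Exponential moments and small balls of the standard Gaussian on the line -/

/-! Both conditions are uniform laws of large numbers for quadratic forms in standard Gaussian
vectors: after rescaling, the rows of each matrix are independent samples of `stdGaussian`. The
basic tool is a Bernstein inequality (`pi_stdGaussian_real_le_abs_mean_sub`) for empirical means of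
functions dominated by `⟪z, ·⟫²`; self-adjointness and a net of the sphere turn it into a spectral
norm bound (`opNorm_le_of_sphereNet`).

WDC. For fixed `x, y, z` the expected active form is exactly the quadratic form of `Qmat x y` at
`z`: orthogonal Gaussian coordinates are independent, which reduces the claim to an integral over a
planar sector (`integral_active_eq_inner_Qmat`). Uniformity in `x, y` is the difficulty, because the
indicators are discontinuous. If all rows have length at most `√(8k)`, moving `x` to a nearby net
point `x₀` changes the sign of `⟪x, g⟫` only for rows in a thin slab around the hyperplane
orthogonal to `x₀`. Slabs carry little second moment, and the slab sums also concentrate over the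
net. The net has logarithmic size of order `k log k` for fixed `ε`, which the width hypothesis pays
for; the row length requirement is the source of the failure term `n e^{-k}`.

RRIC. A set of sign patterns shattered by a linear map of `ℝ^k` has at most `k` elements, so by
Sauer–Shelah each layer splits a linear piece into at most `(n_j + 1)^k` pieces. Thus for fixed
weights the range of the network lies in few subspaces of dimension at most `k`
(`exists_network_pieces`), and `A` is a near isometry on all sums of four of them by a union bound,
as soon as `m` exceeds a multiple of `k log ∏ n_j`. This holds for every deterministic choice of
weights, so independence of `A` from the weights and Fubini suffice, and dependence between layers
does no harm. -/

theorem integrable_gaussianReal_iff {f : ℝ → ℝ} :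
    Integrable f (gaussianReal 0 1) ↔
      Integrable (fun x => f x * gaussianPDFReal 0 1 x) := by
  rw [gaussianReal_of_var_ne_zero _ one_ne_zero, integrable_withDensity_iff
    (measurable_gaussianPDF 0 1) (by simp [gaussianPDF_lt_top])]
  simp

/-- The exponent `1/4` is half the critical value `1/2`, so half of the Gaussian decay survives.
This exponential moment controls all higher moments below. -/
theorem exp_sq_div_four_mul_gaussianPDFReal (x : ℝ) :
    Real.exp (x ^ 2 / 4) * gaussianPDFReal 0 1 x =
      (√(2 * Real.pi))⁻¹ * Real.exp (-(1 / 4) * x ^ 2) := by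
  simp only [gaussianPDFReal_def, NNReal.coe_one, mul_one, sub_zero]
  rw [mul_left_comm, ← Real.exp_add]
  ring_nf

theorem integrable_exp_sq_div_four :
    Integrable (fun x : ℝ => Real.exp (x ^ 2 / 4)) (gaussianReal 0 1) := by
  rw [integrable_gaussianReal_iff]
  simp_rw [exp_sq_div_four_mul_gaussianPDFReal]
  exact (integrable_exp_neg_mul_sq (by norm_num)).const_mul _

theorem integral_exp_sq_div_four :
    ∫ x : ℝ, Real.exp (x ^ 2 / 4) ∂(gaussianReal 0 1) = √2 := by
  rw [integral_gaussianReal_eq_integral_smul one_ne_zero]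
  simp_rw [smul_eq_mul, mul_comm (gaussianPDFReal _ _ _), exp_sq_div_four_mul_gaussianPDFReal]
  rw [integral_const_mul, integral_gaussian, ← Real.sqrt_inv, ← Real.sqrt_mul (by positivity)]
  congr 1
  have := Real.pi_ne_zero
  field_simp
  norm_num

theorem gaussianPDFReal_zero_one_le (x : ℝ) : gaussianPDFReal 0 1 x ≤ 1 / 2 := by
  simp only [gaussianPDFReal_def, NNReal.coe_one, mul_one, sub_zero]
  have h1 : Real.exp (-x ^ 2 / 2) ≤ 1 := Real.exp_le_one_iff.mpr (by nlinarith [sq_nonneg x])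
  have h2 : (2 : ℝ) ≤ √(2 * Real.pi) := by
    apply Real.le_sqrt_of_sq_le
    nlinarith [Real.pi_gt_three]
  calc (√(2 * Real.pi))⁻¹ * Real.exp (-x ^ 2 / 2) ≤ 2⁻¹ * 1 := by gcongr
    _ = 1 / 2 := by norm_num

theorem gaussianReal_real_abs_le {η : ℝ} (hη : 0 ≤ η) :
    (gaussianReal 0 1).real {x | |x| ≤ η} ≤ η := by
  have hs : {x : ℝ | |x| ≤ η} = Set.Icc (-η) η := by
    ext x
    simp [abs_le]
  rw [measureReal_def, gaussianReal_apply_eq_integral _ one_ne_zero, hs, ENNReal.toReal_ofReal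
    (integral_nonneg fun x => gaussianPDFReal_nonneg _ _ _)]
  calc ∫ x in Set.Icc (-η) η, gaussianPDFReal 0 1 x ≤ ∫ x in Set.Icc (-η) η, (1 / 2 : ℝ) := by
        apply setIntegral_mono
        · exact (integrable_gaussianPDFReal 0 1).integrableOn
        · simp
        · exact gaussianPDFReal_zero_one_le
    _ = η := by
        rw [setIntegral_const, Measure.real, Real.volume_Icc, ENNReal.toReal_ofReal (by linarith),
          smul_eq_mul]
        ring

/-- Second order Taylor remainder. The linear term is kept exactly so that the mean survives in the
moment generating function. -/
theorem exp_le_one_add_add_sq_mul_exp_abs (u : ℝ) :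
    Real.exp u ≤ 1 + u + u ^ 2 * Real.exp |u| := by
  have h := Complex.norm_exp_sub_sum_le_norm_mul_exp (u : ℂ) 2
  simp only [Finset.sum_range_succ, Finset.sum_range_zero, pow_zero, Nat.factorial, Nat.cast_one,
    div_one, zero_add, pow_one, Complex.norm_real, Real.norm_eq_abs, sq_abs, mul_one] at h
  rw [← Complex.ofReal_exp, ← Complex.ofReal_one, ← Complex.ofReal_add, ← Complex.ofReal_sub,
    Complex.norm_real, Real.norm_eq_abs] at h
  linarith [le_abs_self (Real.exp u - (1 + u))]

theorem sq_le_mul_exp {s a : ℝ} (hs : 0 ≤ s) (ha : 0 < a) :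
    s ^ 2 ≤ 2 * a ^ 2 * Real.exp (s / a) := by
  have h := Real.quadratic_le_exp_of_nonneg (x := s / a) (by positivity)
  have h2 : s ^ 2 = 2 * a ^ 2 * ((s / a) ^ 2 / 2) := by field_simp
  rw [h2]
  have : 0 ≤ s / a := by positivity
  gcongr
  linarith

theorem pow_four_le_exp (s : ℝ) : s ^ 4 ≤ 32 * Real.exp (s ^ 2 / 4) := by
  have h := sq_le_mul_exp (s := s ^ 2) (a := 4) (by positivity) (by norm_num)
  nlinarith

theorem sq_le_exp (s : ℝ) : s ^ 2 ≤ 4 * Real.exp (s ^ 2 / 4) := by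
  have h := Real.add_one_le_exp (s ^ 2 / 4)
  linarith

/-! ### The standard Gaussian on a Euclidean space -/

section StdGaussian

variable {E : Type*} [NormedAddCommGroup E] [InnerProductSpace ℝ E] [FiniteDimensional ℝ E]
  [MeasurableSpace E] [BorelSpace E]

theorem measurePreserving_inner_stdGaussian {z : E} (hz : ‖z‖ = 1) :
    MeasurePreserving (fun g : E => inner ℝ z g) (stdGaussian E) (gaussianReal 0 1) := by
  refine ⟨by fun_prop, ?_⟩
  have h := IsGaussian.map_eq_gaussianReal (μ := stdGaussian E) (innerSL ℝ z)
  rw [integral_strongDual_stdGaussian, variance_dual_stdGaussian, innerSL_apply_norm, hz] at h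
  simpa using h

theorem integrable_comp_inner {z : E} (hz : ‖z‖ = 1) {f : ℝ → ℝ}
    (hf : Integrable f (gaussianReal 0 1)) :
    Integrable (fun g : E => f (inner ℝ z g)) (stdGaussian E) :=
  (measurePreserving_inner_stdGaussian hz).integrable_comp_of_integrable hf

theorem integral_comp_inner {z : E} (hz : ‖z‖ = 1) {f : ℝ → ℝ}
    (hf : AEStronglyMeasurable f (gaussianReal 0 1)) :
    ∫ g : E, f (inner ℝ z g) ∂(stdGaussian E) = ∫ x, f x ∂(gaussianReal 0 1) := by
  rw [← (measurePreserving_inner_stdGaussian hz).map_eq, integral_map]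
  · exact (measurePreserving_inner_stdGaussian hz).aemeasurable
  · rwa [(measurePreserving_inner_stdGaussian hz).map_eq]

theorem integrable_exp_inner_sq {z : E} (hz : ‖z‖ = 1) :
    Integrable (fun g : E => Real.exp ((inner ℝ z g) ^ 2 / 4)) (stdGaussian E) :=
  integrable_comp_inner hz integrable_exp_sq_div_four

theorem integral_exp_inner_sq_le {z : E} (hz : ‖z‖ = 1) :
    ∫ g : E, Real.exp ((inner ℝ z g) ^ 2 / 4) ∂(stdGaussian E) ≤ 3 / 2 := by
  rw [integral_comp_inner hz integrable_exp_sq_div_four.aestronglyMeasurable,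
    integral_exp_sq_div_four]
  exact Real.sqrt_le_iff.mpr (by norm_num)

theorem integrable_inner_pow_four {z : E} (hz : ‖z‖ = 1) :
    Integrable (fun g : E => (inner ℝ z g) ^ 4) (stdGaussian E) := by
  refine ((integrable_exp_inner_sq hz).const_mul 32).mono' (by fun_prop) (.of_forall fun g => ?_)
  rw [Real.norm_of_nonneg (by positivity)]
  exact pow_four_le_exp _

theorem integrable_inner_sq {z : E} (hz : ‖z‖ = 1) :
    Integrable (fun g : E => (inner ℝ z g) ^ 2) (stdGaussian E) := by
  refine ((integrable_exp_inner_sq hz).const_mul 4).mono' (by fun_prop) (.of_forall fun g => ?_)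
  rw [Real.norm_of_nonneg (by positivity)]
  exact sq_le_exp _

theorem integrable_of_abs_le_inner_sq {z : E} (hz : ‖z‖ = 1) {f : E → ℝ} (hf : Measurable f)
    (hfz : ∀ g, |f g| ≤ (inner ℝ z g) ^ 2) : Integrable f (stdGaussian E) :=
  (integrable_inner_sq hz).mono' hf.aestronglyMeasurable (.of_forall hfz)

theorem integral_inner_pow_four_le {z : E} (hz : ‖z‖ = 1) :
    ∫ g : E, (inner ℝ z g) ^ 4 ∂(stdGaussian E) ≤ 48 := by
  calc ∫ g : E, (inner ℝ z g) ^ 4 ∂(stdGaussian E)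
      ≤ ∫ g : E, 32 * Real.exp ((inner ℝ z g) ^ 2 / 4) ∂(stdGaussian E) :=
        integral_mono (integrable_inner_pow_four hz) ((integrable_exp_inner_sq hz).const_mul 32)
          fun _ => pow_four_le_exp _
    _ ≤ 32 * (3 / 2) := by
        rw [integral_const_mul]
        gcongr
        exact integral_exp_inner_sq_le hz
    _ = 48 := by norm_num

theorem integral_inner_sq {z : E} (hz : ‖z‖ = 1) :
    ∫ g : E, (inner ℝ z g) ^ 2 ∂(stdGaussian E) = 1 := by
  have h := variance_dual_stdGaussian (innerSL ℝ z)
  rw [innerSL_apply_norm, hz, variance_of_integral_eq_zero (by fun_prop)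
    (integral_strongDual_stdGaussian _)] at h
  simpa using h

theorem stdGaussian_real_abs_inner_le {u : E} (hu : ‖u‖ = 1) {η : ℝ} (hη : 0 ≤ η) :
    (stdGaussian E).real {g | |inner ℝ u g| ≤ η} ≤ η := by
  have h := (measurePreserving_inner_stdGaussian hu).measureReal_preimage
    (s := {x : ℝ | |x| ≤ η}) (measurableSet_le (by fun_prop) (by fun_prop)).nullMeasurableSet
  exact h.trans_le (gaussianReal_real_abs_le hη)

/-- Chebyshev's inequality for a functional of variance `‖v‖ ^ 2`. -/
theorem stdGaussian_real_lt_abs_inner_le (v : E) {η : ℝ} (hη : 0 < η) :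
    (stdGaussian E).real {g | η < |inner ℝ v g|} ≤ ‖v‖ ^ 2 / η ^ 2 := by
  by_cases hv : v = 0
  · subst hv
    simp [not_lt.mpr hη.le]
  have hv' : ‖v‖ ≠ 0 := norm_ne_zero_iff.mpr hv
  have hu : ‖(‖v‖⁻¹ • v)‖ = 1 := by simp [norm_smul, hv']
  have h := mul_meas_ge_le_integral_of_nonneg (.of_forall fun g => sq_nonneg _)
    (integrable_inner_sq hu) (η ^ 2 / ‖v‖ ^ 2)
  rw [integral_inner_sq hu] at h
  have hsub : {g : E | η < |inner ℝ v g|} ⊆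
      {g : E | η ^ 2 / ‖v‖ ^ 2 ≤ (inner ℝ (‖v‖⁻¹ • v) g) ^ 2} := by
    intro g (hg : η < _)
    simp only [Set.mem_ofPred_eq, real_inner_smul_left, mul_pow, inv_pow]
    rw [div_eq_inv_mul]
    rw [← sq_abs (inner ℝ v g)]
    gcongr
  have h2 := (measureReal_mono hsub (μ := stdGaussian E))
  rw [div_mul_eq_mul_div, div_le_one (by positivity)] at h
  rw [le_div_iff₀ (by positivity)]
  nlinarith [sq_nonneg η]

/-- A pointwise form of Cauchy–Schwarz: on `S`, `q ≤ τ/2 * q² + 1/(2τ)` with `q = ⟪z, g⟫²`. The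
fourth moment then contributes `24τ` and the measure of `S` contributes `τ/2`. -/
theorem setIntegral_inner_sq_le {z : E} (hz : ‖z‖ = 1) {S : Set E} (hS : MeasurableSet S)
    {τ : ℝ} (hτ : 0 < τ) (h : (stdGaussian E).real S ≤ τ ^ 2) :
    ∫ g, S.indicator (fun g => (inner ℝ z g) ^ 2) g ∂(stdGaussian E) ≤ 25 * τ := by
  have hi : Integrable (S.indicator fun _ => (1 : ℝ)) (stdGaussian E) :=
    (integrable_const _).indicator hS
  calc ∫ g, S.indicator (fun g => (inner ℝ z g) ^ 2) g ∂(stdGaussian E)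
      ≤ ∫ g, (τ / 2 * (inner ℝ z g) ^ 4 + (2 * τ)⁻¹ * S.indicator (fun _ => 1) g)
          ∂(stdGaussian E) := by
        refine integral_mono ((integrable_inner_sq hz).indicator hS)
          (((integrable_inner_pow_four hz).const_mul _).add (hi.const_mul _)) fun g => ?_
        by_cases hg : g ∈ S
        · simp only [Set.indicator_of_mem hg]
          have : 0 ≤ (τ * (inner ℝ z g) ^ 2 - 1) ^ 2 / (2 * τ) := by positivity
          have h2 : (τ * (inner ℝ z g) ^ 2 - 1) ^ 2 / (2 * τ) = τ / 2 * (inner ℝ z g) ^ 4 +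
              (2 * τ)⁻¹ * 1 - (inner ℝ z g) ^ 2 := by
            field_simp
            ring
          linarith
        · simp only [Set.indicator_of_notMem hg]
          positivity
    _ = τ / 2 * ∫ g, (inner ℝ z g) ^ 4 ∂(stdGaussian E) +
          (2 * τ)⁻¹ * (stdGaussian E).real S := by
        rw [integral_add ((integrable_inner_pow_four hz).const_mul _) (hi.const_mul _),
          integral_const_mul, integral_const_mul, integral_indicator_const _ hS]
        simp
    _ ≤ τ / 2 * 48 + (2 * τ)⁻¹ * τ ^ 2 := by
        gcongr
        exact integral_inner_pow_four_le hz
    _ ≤ 25 * τ := by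
        have : (2 * τ)⁻¹ * τ ^ 2 = τ / 2 := by field_simp
        rw [this]
        linarith

/-! ### Concentration of empirical means -/

/-- In the Taylor remainder, `f ^ 2` and `exp |l * f|` are each absorbed into a multiple of `exp (Y
/ 8)`; their product is the exponential moment available for `Y = ⟪z, g⟫²`. -/
theorem exp_mul_le_of_abs_le {f Y l : ℝ} (hf : |f| ≤ Y) (hl : |l| ≤ 1 / 8) :
    Real.exp (l * f) ≤ 1 + l * f + 128 * l ^ 2 * Real.exp (Y / 4) := by
  have hY : 0 ≤ Y := (abs_nonneg _).trans hf
  have h1 := exp_le_one_add_add_sq_mul_exp_abs (l * f)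
  have h2 : Real.exp |l * f| ≤ Real.exp (Y / 8) := by
    rw [abs_mul]
    apply Real.exp_le_exp.mpr
    calc |l| * |f| ≤ 1 / 8 * Y := by gcongr
      _ = Y / 8 := by ring
  have h3 := sq_le_mul_exp hY (show (0 : ℝ) < 8 by norm_num)
  have h4 : f ^ 2 ≤ Y ^ 2 := by
    rw [← sq_abs f]
    gcongr
  calc Real.exp (l * f) ≤ 1 + l * f + (l * f) ^ 2 * Real.exp |l * f| := h1
    _ ≤ 1 + l * f + l ^ 2 * (2 * 8 ^ 2 * Real.exp (Y / 8)) * Real.exp (Y / 8) := by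
        rw [mul_pow]
        gcongr
        exact h4.trans h3
    _ = 1 + l * f + 128 * l ^ 2 * (Real.exp (Y / 8) * Real.exp (Y / 8)) := by ring
    _ = _ := by
        rw [← Real.exp_add]
        ring_nf

theorem integrable_exp_mul_of_abs_le {z : E} (hz : ‖z‖ = 1) {f : E → ℝ} (hf : Measurable f)
    (hfz : ∀ g, |f g| ≤ (inner ℝ z g) ^ 2) {l : ℝ} (hl : |l| ≤ 1 / 8) :
    Integrable (fun g => Real.exp (l * f g)) (stdGaussian E) := by
  refine (integrable_exp_inner_sq hz).mono' (by fun_prop) (.of_forall fun g => ?_)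
  rw [Real.norm_of_nonneg (Real.exp_pos _).le]
  apply Real.exp_le_exp.mpr
  calc l * f g ≤ |l| * |f g| := (le_abs_self _).trans (abs_mul _ _).le
    _ ≤ 1 / 8 * (inner ℝ z g) ^ 2 := by gcongr; exact hfz g
    _ ≤ (inner ℝ z g) ^ 2 / 4 := by nlinarith [sq_nonneg (inner ℝ z g)]

theorem integral_exp_mul_le {z : E} (hz : ‖z‖ = 1) {f : E → ℝ} (hf : Measurable f)
    (hfz : ∀ g, |f g| ≤ (inner ℝ z g) ^ 2) {l : ℝ} (hl : |l| ≤ 1 / 8) :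
    ∫ g, Real.exp (l * f g) ∂(stdGaussian E) ≤
      Real.exp (l * ∫ g, f g ∂(stdGaussian E) + 200 * l ^ 2) := by
  have hfi := integrable_of_abs_le_inner_sq hz hf hfz
  calc ∫ g, Real.exp (l * f g) ∂(stdGaussian E)
      ≤ ∫ g, (1 + l * f g + 128 * l ^ 2 * Real.exp ((inner ℝ z g) ^ 2 / 4)) ∂(stdGaussian E) :=
        integral_mono (integrable_exp_mul_of_abs_le hz hf hfz hl)
          (((integrable_const _).add (hfi.const_mul _)).add
            ((integrable_exp_inner_sq hz).const_mul _))
          fun g => exp_mul_le_of_abs_le (hfz g) hl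
    _ = 1 + l * ∫ g, f g ∂(stdGaussian E) +
          128 * l ^ 2 * ∫ g, Real.exp ((inner ℝ z g) ^ 2 / 4) ∂(stdGaussian E) := by
        have h1 : Integrable (fun g => 1 + l * f g) (stdGaussian E) :=
          (integrable_const _).add (hfi.const_mul _)
        rw [integral_add h1 ((integrable_exp_inner_sq hz).const_mul _),
          integral_add (integrable_const _) (hfi.const_mul _), integral_const_mul,
          integral_const_mul]
        simp
    _ ≤ 1 + l * ∫ g, f g ∂(stdGaussian E) + 128 * l ^ 2 * (3 / 2) := by
        gcongr
        exact integral_exp_inner_sq_le hz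
    _ ≤ (l * ∫ g, f g ∂(stdGaussian E) + 200 * l ^ 2) + 1 := by nlinarith [sq_nonneg l]
    _ ≤ _ := Real.add_one_le_exp _

theorem pi_stdGaussian_real_le_sum {n : ℕ} {z : E} (hz : ‖z‖ = 1) {f : E → ℝ} (hf : Measurable f)
    (hfz : ∀ g, |f g| ≤ (inner ℝ z g) ^ 2) {t : ℝ} (ht0 : 0 ≤ t) (ht1 : t ≤ 1) :
    (Measure.pi fun _ : Fin n => stdGaussian E).real
      {G | n * (∫ g, f g ∂(stdGaussian E)) + n * t ≤ ∑ i, f (G i)} ≤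
        Real.exp (-(n * t ^ 2 / 800)) := by
  -- This minimizes the Chernoff exponent `-l * t + 200 * l ^ 2`, with minimum `-t ^ 2 / 800`.
  set l : ℝ := t / 400 with hl
  have hl' : |l| ≤ 1 / 8 := by
    rw [abs_of_nonneg (by positivity), hl]
    linarith
  have hint := integrable_exp_mul_of_abs_le hz hf hfz hl'
  have hexp : ∀ G : Fin n → E, Real.exp (l * ∑ i, f (G i)) = ∏ i, Real.exp (l * f (G i)) := by
    intro G
    rw [Finset.mul_sum, Real.exp_sum]
  have hi : Integrable (fun G : Fin n → E => Real.exp (l * ∑ i, f (G i)))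
      (Measure.pi fun _ : Fin n => stdGaussian E) := by
    simp_rw [hexp]
    exact Integrable.fintype_prod (f := fun _ g => Real.exp (l * f g)) fun _ => hint
  refine (measure_ge_le_exp_mul_mgf _ (by positivity) hi).trans ?_
  have hm : mgf (fun G : Fin n → E => ∑ i, f (G i)) (Measure.pi fun _ : Fin n => stdGaussian E) l ≤
      Real.exp (l * ∫ g, f g ∂(stdGaussian E) + 200 * l ^ 2) ^ n := by
    rw [mgf]
    simp_rw [hexp]
    rw [integral_fintype_prod_eq_pow (fun g : E => Real.exp (l * f g)), Fintype.card_fin]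
    gcongr
    exact integral_exp_mul_le hz hf hfz hl'
  calc _ ≤ Real.exp (-l * (n * (∫ g, f g ∂(stdGaussian E)) + n * t)) *
        Real.exp (l * ∫ g, f g ∂(stdGaussian E) + 200 * l ^ 2) ^ n := by gcongr
    _ = Real.exp (-(n * t ^ 2 / 800)) := by
        rw [← Real.exp_nat_mul, ← Real.exp_add, hl]
        ring_nf

/-- Bernstein's inequality for the empirical mean of a function dominated by `⟪z, ·⟫²`. -/
theorem pi_stdGaussian_real_le_abs_mean_sub {n : ℕ} (hn : 0 < n) {z : E} (hz : ‖z‖ = 1) {f : E → ℝ}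
    (hf : Measurable f) (hfz : ∀ g, |f g| ≤ (inner ℝ z g) ^ 2) {t : ℝ} (ht0 : 0 ≤ t)
    (ht1 : t ≤ 1) :
    (Measure.pi fun _ : Fin n => stdGaussian E).real
      {G | t < |(n : ℝ)⁻¹ * ∑ i, f (G i) - ∫ g, f g ∂(stdGaussian E)|} ≤
        2 * Real.exp (-(n * t ^ 2 / 800)) := by
  have h1 := pi_stdGaussian_real_le_sum (n := n) hz hf hfz ht0 ht1
  have h2 := pi_stdGaussian_real_le_sum (n := n) hz hf.neg (f := fun g => -f g) (by simpa using hfz)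
    ht0 ht1
  have hn' : (0 : ℝ) < n := by exact_mod_cast hn
  rw [integral_neg] at h2
  have hsub : {G : Fin n → E | t < |(n : ℝ)⁻¹ * ∑ i, f (G i) - ∫ g, f g ∂(stdGaussian E)|} ⊆
      {G | n * (∫ g, f g ∂(stdGaussian E)) + n * t ≤ ∑ i, f (G i)} ∪
      {G | n * (-∫ g, f g ∂(stdGaussian E)) + n * t ≤ ∑ i, -f (G i)} := by
    intro G (hG : t < _)
    have hs : ∑ i, f (G i) = n * ((n : ℝ)⁻¹ * ∑ i, f (G i)) := by field_simp
    rcases lt_abs.mp hG with h | h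
    · left
      simp only [Set.mem_ofPred_eq]
      rw [hs, ← mul_add]
      gcongr
      linarith
    · right
      simp only [Set.mem_ofPred_eq, Finset.sum_neg_distrib]
      rw [hs, ← mul_add, ← mul_neg]
      gcongr
      linarith
  calc _ ≤ _ := measureReal_mono hsub
    _ ≤ _ := measureReal_union_le _ _
    _ ≤ _ := by linarith

end StdGaussian

/-- Chernoff's bound at parameter `1/4`: the moment generating function is `√2 ^ k ≤ e ^ k`, against
the factor `e ^ (-2k)`. -/
theorem stdGaussian_real_norm_sq_ge (k : ℕ) :
    (stdGaussian (EuclideanSpace ℝ (Fin k))).real {g | 8 * (k : ℝ) ≤ ‖g‖ ^ 2} ≤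
      Real.exp (-k) := by
  have hexp : ∀ x : Fin k → ℝ, Real.exp (1 / 4 * ‖WithLp.toLp 2 x‖ ^ 2) =
      ∏ i, Real.exp (x i ^ 2 / 4) := by
    intro x
    rw [EuclideanSpace.real_norm_sq_eq, Finset.mul_sum, Real.exp_sum]
    refine Finset.prod_congr rfl fun i _ => ?_
    congr 1
    simp
    ring
  have hi : Integrable (fun x : Fin k → ℝ => Real.exp (1 / 4 * ‖WithLp.toLp 2 x‖ ^ 2))
      (Measure.pi fun _ => gaussianReal 0 1) := by
    simp_rw [hexp]
    exact Integrable.fintype_prod (f := fun _ x => Real.exp (x ^ 2 / 4))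
      fun _ => integrable_exp_sq_div_four
  have hmeas : MeasurableSet {g : EuclideanSpace ℝ (Fin k) | 8 * (k : ℝ) ≤ ‖g‖ ^ 2} :=
    measurableSet_le (by fun_prop) (by fun_prop)
  rw [← map_pi_eq_stdGaussian, map_measureReal_apply (by fun_prop) hmeas]
  refine (measure_ge_le_exp_mul_mgf (8 * (k : ℝ)) (by norm_num) hi).trans ?_
  rw [mgf]
  simp_rw [hexp]
  rw [integral_fintype_prod_eq_pow (fun x : ℝ => Real.exp (x ^ 2 / 4)), Fintype.card_fin,
    integral_exp_sq_div_four]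
  have h : √2 ≤ Real.exp 1 := by
    have : √2 ≤ 2 := Real.sqrt_le_iff.mpr (by norm_num)
    linarith [Real.add_one_le_exp (1 : ℝ)]
  calc Real.exp (-(1 / 4) * (8 * k)) * √2 ^ k
      ≤ Real.exp (-(1 / 4) * (8 * k)) * Real.exp 1 ^ k := by gcongr
    _ = Real.exp (-k) := by
      rw [← Real.exp_nat_mul, ← Real.exp_add]
      ring_nf

/-! ### Sector integrals of the planar standard Gaussian -/

theorem integral_prod_gaussianReal (F : ℝ × ℝ → ℝ) :
    ∫ p, F p ∂((gaussianReal 0 1).prod (gaussianReal 0 1)) =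
      ∫ p : ℝ × ℝ, (2 * Real.pi)⁻¹ * Real.exp (-(1 / 2) * (p.1 ^ 2 + p.2 ^ 2)) * F p := by
  rw [gaussianReal_of_var_ne_zero _ one_ne_zero,
    prod_withDensity (measurable_gaussianPDF 0 1) (measurable_gaussianPDF 0 1),
    integral_withDensity_eq_integral_toReal_smul (by fun_prop)
      (.of_forall fun p => ENNReal.mul_lt_top gaussianPDF_lt_top gaussianPDF_lt_top)]
  rw [← Measure.volume_eq_prod]
  congr 1
  ext p
  rw [ENNReal.toReal_mul, toReal_gaussianPDF, toReal_gaussianPDF, smul_eq_mul]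
  congr 1
  simp only [gaussianPDFReal_def, NNReal.coe_one, mul_one, sub_zero]
  have h : √(2 * Real.pi) * √(2 * Real.pi) = 2 * Real.pi :=
    Real.mul_self_sqrt (by positivity)
  rw [mul_mul_mul_comm, ← mul_inv, h, ← Real.exp_add]
  ring_nf

/-- In polar coordinates the Gaussian weight is radial, so a homogeneous integrand separates; the
extra power of `r` is the Jacobian. -/
theorem integral_prod_gaussianReal_of_homogeneous {F : ℝ × ℝ → ℝ} {f : ℝ → ℝ} (q : ℕ)
    (hF : ∀ r φ : ℝ, 0 < r → F (r * Real.cos φ, r * Real.sin φ) = r ^ q * f φ) :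
    ∫ p, F p ∂((gaussianReal 0 1).prod (gaussianReal 0 1)) =
      (2 * Real.pi)⁻¹ * (∫ r in Set.Ioi (0 : ℝ), r ^ (q + 1) * Real.exp (-(1 / 2) * r ^ 2)) *
        ∫ φ in Set.Ioo (-Real.pi) Real.pi, f φ := by
  rw [integral_prod_gaussianReal, ← integral_comp_polarCoord_symm, polarCoord_target, mul_assoc,
    ← setIntegral_prod_mul, ← integral_const_mul, ← Measure.volume_eq_prod]
  refine setIntegral_congr_fun (measurableSet_Ioi.prod measurableSet_Ioo) ?_
  rintro ⟨r, φ⟩ ⟨hr, -⟩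
  simp only [polarCoord_symm_apply, smul_eq_mul, hF r φ hr]
  have h : (r * Real.cos φ) ^ 2 + (r * Real.sin φ) ^ 2 = r ^ 2 := by
    linear_combination r ^ 2 * Real.cos_sq_add_sin_sq φ
  rw [h]
  ring

theorem integral_pow_one_mul_exp :
    ∫ r in Set.Ioi (0 : ℝ), r ^ 1 * Real.exp (-(1 / 2) * r ^ 2) = 1 := by
  have h := integral_rpow_mul_exp_neg_mul_rpow (p := 2) (q := 1) (b := 1 / 2) (by norm_num)
    (by norm_num) (by norm_num)
  norm_num at h
  simpa [Real.rpow_neg_one] using h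

theorem integral_pow_three_mul_exp :
    ∫ r in Set.Ioi (0 : ℝ), r ^ 3 * Real.exp (-(1 / 2) * r ^ 2) = 2 := by
  have h := integral_rpow_mul_exp_neg_mul_rpow (p := 2) (q := 3) (b := 1 / 2) (by norm_num)
    (by norm_num) (by norm_num)
  have h2 : (1 / 2 : ℝ) ^ (-(3 + 1) / 2 : ℝ) = 4 := by
    rw [show (-(3 + 1) / 2 : ℝ) = -2 by norm_num, Real.rpow_neg (by norm_num)]
    norm_num
  have h3 : Real.Gamma ((3 + 1) / 2) = 1 := by
    rw [show ((3 + 1) / 2 : ℝ) = 2 by norm_num, Real.Gamma_two]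
  rw [h2, h3] at h
  norm_num at h ⊢
  exact_mod_cast h

/-- Two half-planes whose normals make the angle `θ` meet in an arc of directions of length `π - θ`.
-/
theorem sector_iff {θ φ : ℝ} (hθ0 : 0 ≤ θ) (hθ1 : θ ≤ Real.pi)
    (hφ : φ ∈ Set.Ioo (-Real.pi) Real.pi) :
    (0 < Real.cos φ ∧ 0 < Real.cos (φ - θ)) ↔ φ ∈ Set.Ioo (θ - Real.pi / 2) (Real.pi / 2) := by
  obtain ⟨h1, h2⟩ := hφ
  constructor
  · rintro ⟨h3, h4⟩
    have h5 : φ < Real.pi / 2 := by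
      by_contra! h
      linarith [Real.cos_nonpos_of_pi_div_two_le_of_le h (by linarith)]
    refine ⟨?_, h5⟩
    by_contra! h
    rw [← Real.cos_neg] at h3 h4
    have h6 : -Real.pi / 2 < φ := by
      by_contra! h
      linarith [Real.cos_nonpos_of_pi_div_two_le_of_le (x := -φ) (by linarith) (by linarith)]
    linarith [Real.cos_nonpos_of_pi_div_two_le_of_le (x := -(φ - θ)) (by linarith) (by linarith)]
  · rintro ⟨h3, h4⟩
    exact ⟨Real.cos_pos_of_mem_Ioo ⟨by linarith, by linarith⟩,
      Real.cos_pos_of_mem_Ioo ⟨by linarith, by linarith⟩⟩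

theorem setIntegral_sector {θ : ℝ} (hθ0 : 0 ≤ θ) (hθ1 : θ ≤ Real.pi) (f : ℝ → ℝ) :
    ∫ φ in Set.Ioo (-Real.pi) Real.pi,
        (if 0 < Real.cos φ ∧ 0 < Real.cos (φ - θ) then f φ else 0) =
      ∫ φ in (θ - Real.pi / 2)..(Real.pi / 2), f φ := by
  have hpi := Real.pi_pos
  rw [intervalIntegral.integral_of_le (by linarith), integral_Ioc_eq_integral_Ioo]
  have hsub : Set.Ioo (θ - Real.pi / 2) (Real.pi / 2) ⊆ Set.Ioo (-Real.pi) Real.pi :=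
    Set.Ioo_subset_Ioo (by linarith) (by linarith)
  rw [← Set.inter_eq_right.mpr hsub, ← setIntegral_indicator measurableSet_Ioo]
  refine setIntegral_congr_fun measurableSet_Ioo fun φ hφ => ?_
  simp only [sector_iff hθ0 hθ1 hφ, Set.indicator_apply]

theorem sector_polar_iff {θ r φ : ℝ} (hr : 0 < r) :
    (0 < r * Real.cos φ ∧ 0 < Real.cos θ * (r * Real.cos φ) + Real.sin θ * (r * Real.sin φ)) ↔
      (0 < Real.cos φ ∧ 0 < Real.cos (φ - θ)) := by
  rw [Real.cos_sub, show Real.cos θ * (r * Real.cos φ) + Real.sin θ * (r * Real.sin φ) =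
    r * (Real.cos φ * Real.cos θ + Real.sin φ * Real.sin θ) by ring, mul_pos_iff_of_pos_left hr,
    mul_pos_iff_of_pos_left hr]

theorem integral_sector_one {θ : ℝ} (hθ0 : 0 ≤ θ) (hθ1 : θ ≤ Real.pi) :
    ∫ p : ℝ × ℝ, (if 0 < p.1 ∧ 0 < Real.cos θ * p.1 + Real.sin θ * p.2 then 1 else 0 : ℝ)
        ∂((gaussianReal 0 1).prod (gaussianReal 0 1)) = (Real.pi - θ) / (2 * Real.pi) := by
  rw [integral_prod_gaussianReal_of_homogeneous 0
    (f := fun φ => if 0 < Real.cos φ ∧ 0 < Real.cos (φ - θ) then 1 else 0)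
    (fun r φ hr => by simp only [sector_polar_iff hr, pow_zero, one_mul]),
    setIntegral_sector hθ0 hθ1, zero_add, integral_pow_one_mul_exp]
  simp
  ring

/-- The last bracket is the quadratic form of the planar reflection that exchanges `(1, 0)` and
`(cos θ, sin θ)`, which is how the swap matrix arises. -/
theorem integral_sector_sq {θ : ℝ} (hθ0 : 0 ≤ θ) (hθ1 : θ ≤ Real.pi) (a b : ℝ) :
    ∫ p : ℝ × ℝ, (if 0 < p.1 ∧ 0 < Real.cos θ * p.1 + Real.sin θ * p.2
        then (a * p.1 + b * p.2) ^ 2 else 0) ∂((gaussianReal 0 1).prod (gaussianReal 0 1)) =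
      (Real.pi - θ) / (2 * Real.pi) * (a ^ 2 + b ^ 2) + Real.sin θ / (2 * Real.pi) *
        (a ^ 2 * Real.cos θ + 2 * a * b * Real.sin θ - b ^ 2 * Real.cos θ) := by
  rw [integral_prod_gaussianReal_of_homogeneous 2
    (f := fun φ => if 0 < Real.cos φ ∧ 0 < Real.cos (φ - θ)
      then (a * Real.cos φ + b * Real.sin φ) ^ 2 else 0)
    (fun r φ hr => by
      simp only [sector_polar_iff hr]
      split_ifs
      · ring
      · ring),
    setIntegral_sector hθ0 hθ1, integral_pow_three_mul_exp]
  have h : ∀ φ : ℝ, (a * Real.cos φ + b * Real.sin φ) ^ 2 =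
      a ^ 2 * Real.cos φ ^ 2 + 2 * a * b * (Real.sin φ * Real.cos φ) + b ^ 2 * Real.sin φ ^ 2 := by
    intro φ
    ring
  simp_rw [h]
  rw [intervalIntegral.integral_add, intervalIntegral.integral_add,
    intervalIntegral.integral_const_mul, intervalIntegral.integral_const_mul,
    intervalIntegral.integral_const_mul, integral_cos_sq, integral_sin_sq, integral_sin_mul_cos₁]
  · simp only [Real.cos_pi_div_two, Real.sin_pi_div_two, Real.sin_sub_pi_div_two,
      Real.cos_sub_pi_div_two]
    have hs : Real.cos θ ^ 2 = 1 - Real.sin θ ^ 2 := by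
      linarith [Real.sin_sq_add_cos_sq θ]
    have := Real.pi_ne_zero
    field_simp
    linear_combination (-4 * a * b) * hs
  all_goals exact Continuous.intervalIntegrable (by fun_prop) _ _

/-! ### Orthogonal coordinates of the standard Gaussian are independent -/

section Coordinates

variable {E : Type*} [NormedAddCommGroup E] [InnerProductSpace ℝ E] [FiniteDimensional ℝ E]
  [MeasurableSpace E] [BorelSpace E]

/-- The characteristic functions agree, since `‖∑ tᵢ vᵢ‖ = ‖t‖` for an orthonormal family. -/
theorem map_inner_stdGaussian {ι : Type*} [Fintype ι] {v : ι → E} (hv : Orthonormal ℝ v) :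
    (stdGaussian E).map (fun g i => inner ℝ (v i) g) =
      Measure.pi fun _ : ι => gaussianReal 0 1 := by
  have h : (stdGaussian E).map (fun g => WithLp.toLp 2 fun i => inner ℝ (v i) g) =
      stdGaussian (EuclideanSpace ℝ ι) := by
    have : IsProbabilityMeasure
        ((stdGaussian E).map (fun g => WithLp.toLp 2 fun i => inner ℝ (v i) g)) :=
      Measure.isProbabilityMeasure_map (by fun_prop)
    apply Measure.ext_of_charFun
    ext t
    have ht : ∀ g : E, inner ℝ (WithLp.toLp 2 fun i => inner ℝ (v i) g) t =
        inner ℝ g (∑ i, t i • v i) := by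
      intro g
      simp [PiLp.inner_apply, inner_sum, real_inner_smul_right, real_inner_comm]
    have hn : ‖t‖ = ‖∑ i, t i • v i‖ := by
      rw [← sq_eq_sq₀ (norm_nonneg _) (norm_nonneg _),
        ← real_inner_self_eq_norm_sq (∑ i, t i • v i), hv.inner_sum, EuclideanSpace.real_norm_sq_eq]
      simp [sq]
    rw [charFun_stdGaussian, hn, ← charFun_stdGaussian, charFun_apply,
      integral_map (by fun_prop) (by fun_prop), charFun_apply]
    simp_rw [ht]
  rw [← map_pi_eq_stdGaussian] at h
  have h2 := congrArg (Measure.map (WithLp.ofLp : EuclideanSpace ℝ ι → ι → ℝ)) h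
  rw [Measure.map_map (by fun_prop) (by fun_prop), Measure.map_map (by fun_prop) (by fun_prop)]
    at h2
  simpa [Function.comp_def] using h2

theorem iIndepFun_inner_stdGaussian {ι : Type*} [Fintype ι] {v : ι → E} (hv : Orthonormal ℝ v) :
    iIndepFun (fun i g => inner ℝ (v i) g) (stdGaussian E) := by
  rw [iIndepFun_iff_map_fun_eq_pi_map (fun i => by fun_prop), map_inner_stdGaussian hv]
  congr 1
  ext1 i
  exact (measurePreserving_inner_stdGaussian (hv.norm_eq_one i)).map_eq.symm

theorem map_inner_prod_stdGaussian {e₁ e₂ : E} (h1 : ‖e₁‖ = 1) (h2 : ‖e₂‖ = 1)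
    (h12 : inner ℝ e₁ e₂ = 0) :
    (stdGaussian E).map (fun g => (inner ℝ e₁ g, inner ℝ e₂ g)) =
      (gaussianReal 0 1).prod (gaussianReal 0 1) := by
  have hv : Orthonormal ℝ ![e₁, e₂] := by
    simp [orthonormal_vecCons_iff, h1, h2, h12]
  have h := (iIndepFun_inner_stdGaussian hv).indepFun (i := 0) (j := 1) (by simp)
  rw [indepFun_iff_map_prod_eq_prod_map_map (by fun_prop) (by fun_prop)] at h
  simp only [Matrix.cons_val_zero, Matrix.cons_val_one] at h
  rw [h, (measurePreserving_inner_stdGaussian h1).map_eq,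
    (measurePreserving_inner_stdGaussian h2).map_eq]

/-- Integration against `⟪w, ·⟫` and `⟪w, ·⟫²` for `w` orthogonal to an orthonormal pair. -/
theorem integral_mul_inner_of_orthogonal {e₁ e₂ w : E} (h1 : ‖e₁‖ = 1) (h2 : ‖e₂‖ = 1)
    (h12 : inner ℝ e₁ e₂ = 0) (h1w : inner ℝ e₁ w = 0) (h2w : inner ℝ e₂ w = 0)
    {F : ℝ × ℝ → ℝ} (hF : Measurable F) :
    (∫ g, F (inner ℝ e₁ g, inner ℝ e₂ g) * inner ℝ w g ∂(stdGaussian E) = 0) ∧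
      ∫ g, F (inner ℝ e₁ g, inner ℝ e₂ g) * (inner ℝ w g) ^ 2 ∂(stdGaussian E) =
        (∫ p, F p ∂((gaussianReal 0 1).prod (gaussianReal 0 1))) * ‖w‖ ^ 2 := by
  by_cases hw : w = 0
  · simp [hw]
  have hw' : ‖w‖ ≠ 0 := norm_ne_zero_iff.mpr hw
  set u : E := ‖w‖⁻¹ • w with hu
  have hu1 : ‖u‖ = 1 := by simp [hu, norm_smul, hw']
  have hwu : ∀ g, inner ℝ w g = ‖w‖ * inner ℝ u g := by
    intro g
    rw [hu, real_inner_smul_left, mul_inv_cancel_left₀ hw']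
  have hv : Orthonormal ℝ ![e₁, e₂, u] := by
    simp [orthonormal_vecCons_iff, h1, h2, h12, Fin.forall_fin_two, hu,
      real_inner_smul_right, h1w, h2w, norm_smul, hw']
  have hind := (iIndepFun_inner_stdGaussian hv).indepFun_prodMk (fun i => by fun_prop) 0 1 2
    (by simp) (by simp)
  simp only [Matrix.cons_val_zero, Matrix.cons_val_one, Matrix.cons_val] at hind
  have hFp : ∫ g, F (inner ℝ e₁ g, inner ℝ e₂ g) ∂(stdGaussian E) =
      ∫ p, F p ∂((gaussianReal 0 1).prod (gaussianReal 0 1)) := by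
    rw [← map_inner_prod_stdGaussian h1 h2 h12, integral_map (by fun_prop)
      hF.aestronglyMeasurable]
  have key : ∀ φ : ℝ → ℝ, Measurable φ →
      ∫ g, F (inner ℝ e₁ g, inner ℝ e₂ g) * φ (inner ℝ u g) ∂(stdGaussian E) =
        (∫ p, F p ∂((gaussianReal 0 1).prod (gaussianReal 0 1))) *
          ∫ g, φ (inner ℝ u g) ∂(stdGaussian E) := by
    intro φ hφ
    rw [← hFp]
    exact (hind.comp hF hφ).integral_fun_mul_eq_mul_integral
      (hF.comp (by fun_prop)).aestronglyMeasurable (hφ.comp (by fun_prop)).aestronglyMeasurable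
  constructor
  · have h := key id measurable_id
    have h0 : ∫ g, inner ℝ u g ∂(stdGaussian E) = 0 :=
      integral_strongDual_stdGaussian (innerSL ℝ u)
    simp only [id, h0, mul_zero] at h
    simp_rw [hwu, mul_left_comm _ ‖w‖]
    rw [integral_const_mul, h, mul_zero]
  · have h := key (fun x => x ^ 2) (by fun_prop)
    rw [integral_inner_sq hu1, mul_one] at h
    simp_rw [hwu, mul_pow, mul_left_comm _ (‖w‖ ^ 2)]
    rw [integral_const_mul, h, mul_comm]

end Coordinates

/-! ### The expected active Gram matrix -/

section ExpectedGram

variable {E : Type*} [NormedAddCommGroup E] [InnerProductSpace ℝ E] [FiniteDimensional ℝ E]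

theorem exists_orthonormal_angle (hE : 2 ≤ Module.finrank ℝ E) {u v : E} (hu : ‖u‖ = 1)
    (hv : ‖v‖ = 1) :
    ∃ e : E, ‖e‖ = 1 ∧ inner ℝ u e = 0 ∧
      v = Real.cos (InnerProductGeometry.angle u v) • u +
        Real.sin (InnerProductGeometry.angle u v) • e := by
  set θ := InnerProductGeometry.angle u v with hθ
  have hc : Real.cos θ = inner ℝ u v := by
    rw [hθ, InnerProductGeometry.cos_angle, hu, hv]
    simp
  have hs0 : 0 ≤ Real.sin θ := InnerProductGeometry.sin_angle_nonneg u v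
  set w := v - Real.cos θ • u with hw
  have huw : inner ℝ u w = 0 := by
    rw [hw, inner_sub_right, real_inner_smul_right, real_inner_self_eq_norm_sq, hu, hc]
    ring
  have hwn : ‖w‖ = Real.sin θ := by
    rw [← sq_eq_sq₀ (norm_nonneg _) hs0, hw, norm_sub_sq_real, real_inner_smul_right, norm_smul,
      hu, hv, real_inner_comm, ← hc, Real.norm_eq_abs, mul_one, sq_abs, Real.sin_sq]
    ring
  by_cases hw0 : w = 0
  -- Here `u` and `v` are parallel and the sine vanishes, so any unit vector orthogonal to `u`
  -- serves; it exists because the dimension is at least two.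
  · obtain ⟨e, he⟩ : ∃ e : (ℝ ∙ u)ᗮ, e ≠ 0 := by
      have h1 : 0 < Module.finrank ℝ (ℝ ∙ u)ᗮ := by
        have h2 := Submodule.finrank_add_finrank_orthogonal (ℝ ∙ u)
        have h3 : Module.finrank ℝ (ℝ ∙ u) ≤ 1 := (finrank_span_le_card {u}).trans (by simp)
        omega
      have := Module.finrank_pos_iff.mp h1
      exact exists_ne 0
    have he' : ‖(e : E)‖ ≠ 0 := by simpa using he
    refine ⟨‖(e : E)‖⁻¹ • (e : E), by simp [norm_smul, he'], ?_, ?_⟩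
    · rw [real_inner_smul_right, Submodule.mem_orthogonal_singleton_iff_inner_right.mp e.2,
        mul_zero]
    · rw [← hwn, hw0, norm_zero, zero_smul, add_zero]
      exact sub_eq_zero.mp hw0
  · have hw' : ‖w‖ ≠ 0 := norm_ne_zero_iff.mpr hw0
    refine ⟨‖w‖⁻¹ • w, by simp [norm_smul, hw'], by rw [real_inner_smul_right, huw, mul_zero], ?_⟩
    rw [← hwn, smul_inv_smul₀ hw', hw]
    abel

variable [MeasurableSpace E] [BorelSpace E]

/-- With `z = a e₁ + b e₂ + w` and `w` orthogonal to the plane, the sector depends only on the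
planar coordinates, which are independent of `⟪w, g⟫`. The cross term has mean zero, the `w` term
gives `‖w‖ ^ 2` times the sector's probability, and the rest is the planar integral. -/
theorem integral_active_inner_sq {e₁ e₂ : E} (h1 : ‖e₁‖ = 1) (h2 : ‖e₂‖ = 1)
    (h12 : inner ℝ e₁ e₂ = 0) {θ : ℝ} (hθ0 : 0 ≤ θ) (hθ1 : θ ≤ Real.pi) (z : E) :
    ∫ g, (if 0 < inner ℝ e₁ g ∧ 0 < inner ℝ (Real.cos θ • e₁ + Real.sin θ • e₂) g
        then (inner ℝ z g) ^ 2 else 0) ∂(stdGaussian E) =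
      (Real.pi - θ) / (2 * Real.pi) * ‖z‖ ^ 2 + Real.sin θ / (2 * Real.pi) *
        ((inner ℝ e₁ z) ^ 2 * Real.cos θ + 2 * inner ℝ e₁ z * inner ℝ e₂ z * Real.sin θ -
          (inner ℝ e₂ z) ^ 2 * Real.cos θ) := by
  set a := inner ℝ e₁ z with ha
  set b := inner ℝ e₂ z with hb
  set w := z - a • e₁ - b • e₂ with hw
  have h21 : inner ℝ e₂ e₁ = 0 := by rw [real_inner_comm, h12]
  have h1w : inner ℝ e₁ w = 0 := by
    simp [hw, inner_sub_right, real_inner_smul_right, h1, h12, ← ha]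
  have h2w : inner ℝ e₂ w = 0 := by
    simp [hw, inner_sub_right, real_inner_smul_right, h2, h21, ← hb]
  have hz : z = (a • e₁ + b • e₂) + w := by
    rw [hw]
    abel
  have hzn : ‖z‖ ^ 2 = a ^ 2 + b ^ 2 + ‖w‖ ^ 2 := by
    have hab : inner ℝ (a • e₁ + b • e₂) w = 0 := by
      rw [inner_add_left, real_inner_smul_left, real_inner_smul_left, h1w, h2w]
      ring
    have h3 : ‖a • e₁ + b • e₂‖ ^ 2 = a ^ 2 + b ^ 2 := by
      rw [norm_add_sq_real, norm_smul, norm_smul, h1, h2, real_inner_smul_left,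
        real_inner_smul_right, h12]
      simp
    conv_lhs => rw [hz]
    rw [norm_add_sq_real, hab, h3]
    ring
  set S : Set (ℝ × ℝ) := {p | 0 < p.1 ∧ 0 < Real.cos θ * p.1 + Real.sin θ * p.2} with hS
  have hSm : MeasurableSet S := by
    rw [hS, Set.ofPred_and]
    exact (measurableSet_lt (by fun_prop) (by fun_prop)).inter
      (measurableSet_lt (by fun_prop) (by fun_prop))
  classical
  set F₀ : ℝ × ℝ → ℝ := fun p => if p ∈ S then 1 else 0 with hF₀
  set F₁ : ℝ × ℝ → ℝ := fun p => if p ∈ S then 2 * (a * p.1 + b * p.2) else 0 with hF₁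
  set F₂ : ℝ × ℝ → ℝ := fun p => if p ∈ S then (a * p.1 + b * p.2) ^ 2 else 0 with hF₂
  have m0 : Measurable F₀ := Measurable.ite hSm (by fun_prop) (by fun_prop)
  have m1 : Measurable F₁ := Measurable.ite hSm (by fun_prop) (by fun_prop)
  have m2 : Measurable F₂ := Measurable.ite hSm (by fun_prop) (by fun_prop)
  set P : E → ℝ × ℝ := fun g => (inner ℝ e₁ g, inner ℝ e₂ g) with hP
  have mP : Measurable P := by fun_prop
  have hdecomp : ∀ g, (if 0 < inner ℝ e₁ g ∧ 0 < inner ℝ (Real.cos θ • e₁ + Real.sin θ • e₂) g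
        then (inner ℝ z g) ^ 2 else 0) =
      F₂ (P g) + (F₁ (P g) * inner ℝ w g + F₀ (P g) * (inner ℝ w g) ^ 2) := by
    intro g
    have hzg : inner ℝ z g = a * inner ℝ e₁ g + b * inner ℝ e₂ g + inner ℝ w g := by
      conv_lhs => rw [hz]
      simp [inner_add_left, real_inner_smul_left]
    rw [inner_add_left, real_inner_smul_left, real_inner_smul_left]
    simp only [hF₀, hF₁, hF₂, hP, hS, Set.mem_ofPred_eq, hzg]
    split_ifs
    · ring
    · ring
  have i1 := integrable_inner_sq h1
  have i2 := integrable_inner_sq h2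
  have iw : Integrable (fun g : E => (inner ℝ w g) ^ 2) (stdGaussian E) :=
    (IsGaussian.memLp_dual (stdGaussian E) (innerSL ℝ w) 2 (by simp)).integrable_sq
  have if0 : Integrable (fun g => F₀ (P g) * (inner ℝ w g) ^ 2) (stdGaussian E) := by
    refine iw.mono' (by fun_prop) (.of_forall fun g => ?_)
    simp only [hF₀]
    split_ifs
    · simp
    · simp [sq_nonneg]
  have if1 : Integrable (fun g => F₁ (P g) * inner ℝ w g) (stdGaussian E) := by
    refine (((i1.const_mul (2 * a ^ 2)).add (i2.const_mul (2 * b ^ 2))).add iw).mono'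
      (by fun_prop) (.of_forall fun g => ?_)
    simp only [hF₁, hP, Pi.add_apply, Real.norm_eq_abs]
    split_ifs
    · apply abs_le.mpr
      constructor <;>
        nlinarith [sq_nonneg (a * inner ℝ e₁ g - b * inner ℝ e₂ g),
          sq_nonneg (a * inner ℝ e₁ g + b * inner ℝ e₂ g + inner ℝ w g),
          sq_nonneg (a * inner ℝ e₁ g + b * inner ℝ e₂ g - inner ℝ w g)]
    · simp only [zero_mul, abs_zero]
      positivity
  have if2 : Integrable (fun g => F₂ (P g)) (stdGaussian E) := by
    refine ((i1.const_mul (2 * a ^ 2)).add (i2.const_mul (2 * b ^ 2))).mono'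
      (m2.comp mP).aestronglyMeasurable (.of_forall fun g => ?_)
    simp only [hF₂, hP, Pi.add_apply, Real.norm_eq_abs]
    split_ifs
    · rw [abs_of_nonneg (by positivity)]
      nlinarith [sq_nonneg (a * inner ℝ e₁ g - b * inner ℝ e₂ g)]
    · simp only [abs_zero]
      positivity
  simp_rw [hdecomp]
  have ho0 := (integral_mul_inner_of_orthogonal h1 h2 h12 h1w h2w m0).2
  have ho1 := (integral_mul_inner_of_orthogonal h1 h2 h12 h1w h2w m1).1
  have hi2 : ∫ g, F₂ (P g) ∂(stdGaussian E) =
      ∫ p, F₂ p ∂((gaussianReal 0 1).prod (gaussianReal 0 1)) := by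
    rw [← map_inner_prod_stdGaussian h1 h2 h12, integral_map mP.aemeasurable
      m2.aestronglyMeasurable]
  have hs0 : ∫ p, F₀ p ∂((gaussianReal 0 1).prod (gaussianReal 0 1)) =
      (Real.pi - θ) / (2 * Real.pi) := integral_sector_one hθ0 hθ1
  have hs2 := integral_sector_sq hθ0 hθ1 a b
  have if10 : Integrable (fun g => F₁ (P g) * inner ℝ w g + F₀ (P g) * (inner ℝ w g) ^ 2)
      (stdGaussian E) := if1.add if0
  rw [integral_add if2 if10, integral_add if1 if0, ho1, ho0, hi2, hs0,
    show ∫ p, F₂ p ∂((gaussianReal 0 1).prod (gaussianReal 0 1)) = _ from hs2, hzn]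
  ring

end ExpectedGram

theorem inner_lineProj_mulVec {k : ℕ} (u z : EuclideanSpace ℝ (Fin k)) :
    inner ℝ z (WithLp.toLp 2 (lineProj u *ᵥ z.ofLp)) = (‖u‖ ^ 2)⁻¹ * (inner ℝ u z) ^ 2 := by
  rw [lineProj_mulVec, real_inner_smul_right, real_inner_comm]
  ring

theorem inner_Qmat_mulVec {k : ℕ} (x y z : EuclideanSpace ℝ (Fin k)) :
    inner ℝ z (WithLp.toLp 2 (Qmat x y *ᵥ z.ofLp)) =
      (Real.pi - InnerProductGeometry.angle x y) / (2 * Real.pi) * ‖z‖ ^ 2 +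
        Real.sin (InnerProductGeometry.angle x y) / (2 * Real.pi) *
          ((‖normalized x + normalized y‖ ^ 2)⁻¹ * (inner ℝ (normalized x + normalized y) z) ^ 2 -
            (‖normalized x - normalized y‖ ^ 2)⁻¹ *
              (inner ℝ (normalized x - normalized y) z) ^ 2) := by
  rw [Qmat, Matrix.add_mulVec, Matrix.smul_mulVec, Matrix.smul_mulVec, Matrix.one_mulVec,
    WithLp.toLp_add, WithLp.toLp_smul, WithLp.toLp_smul, inner_add_right, real_inner_smul_right,
    real_inner_smul_right, swapMatrix, Matrix.sub_mulVec, WithLp.toLp_sub, inner_sub_right,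
    inner_lineProj_mulVec, inner_lineProj_mulVec, WithLp.toLp_ofLp, real_inner_self_eq_norm_sq]

theorem integral_active_eq_inner_Qmat {k : ℕ} (hk : 2 ≤ k) {x y : EuclideanSpace ℝ (Fin k)}
    (hx : x ≠ 0) (hy : y ≠ 0) (z : EuclideanSpace ℝ (Fin k)) :
    ∫ g, (if 0 < inner ℝ x g ∧ 0 < inner ℝ y g then (inner ℝ z g) ^ 2 else 0)
        ∂(stdGaussian (EuclideanSpace ℝ (Fin k))) =
      inner ℝ z (WithLp.toLp 2 (Qmat x y *ᵥ z.ofLp)) := by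
  have hx' : 0 < ‖x‖⁻¹ := inv_pos.mpr (norm_pos_iff.mpr hx)
  have hy' : 0 < ‖y‖⁻¹ := inv_pos.mpr (norm_pos_iff.mpr hy)
  have hu := norm_normalized hx
  have hv := norm_normalized hy
  have hangle : InnerProductGeometry.angle (normalized x) (normalized y) =
      InnerProductGeometry.angle x y := by
    rw [normalized, normalized, InnerProductGeometry.angle_smul_left_of_pos _ _ hx',
      InnerProductGeometry.angle_smul_right_of_pos _ _ hy']
  obtain ⟨e, he, hue, hve⟩ := exists_orthonormal_angle (by simpa using hk) hu hv
  rw [hangle] at hve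
  rw [inner_Qmat_mulVec]
  set θ := InnerProductGeometry.angle x y with hθ
  set u := normalized x with hux
  set v := normalized y with hvy
  have hpos : ∀ g, (0 < inner ℝ x g ∧ 0 < inner ℝ y g) ↔ (0 < inner ℝ u g ∧ 0 < inner ℝ v g) := by
    intro g
    rw [hux, hvy, normalized, normalized, real_inner_smul_left, real_inner_smul_left,
      mul_pos_iff_of_pos_left hx', mul_pos_iff_of_pos_left hy']
  simp_rw [hpos]
  have hint := integral_active_inner_sq hu he hue (InnerProductGeometry.angle_nonneg x y)
    (InnerProductGeometry.angle_le_pi x y) z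
  rw [← hθ, ← hve] at hint
  rw [hint]
  congr 1
  -- For parallel vectors one of `1 + c`, `1 - c` vanishes, but the swap term then has coefficient
  -- zero. Otherwise `‖u ± v‖ ^ 2 = 2 (1 ± c)` may be divided by.
  by_cases hs : Real.sin θ = 0
  · simp [hs]
  congr 1
  have hcs := Real.sin_sq_add_cos_sq θ
  set c := Real.cos θ with hc
  set s := Real.sin θ with hs'
  have hs2 : 0 < s ^ 2 := by positivity
  have hc1 : 1 + c ≠ 0 := fun h => by
    have : c = -1 := by linarith
    nlinarith
  have hc2 : 1 - c ≠ 0 := fun h => by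
    have : c = 1 := by linarith
    nlinarith
  have huv : inner ℝ u v = c := by
    rw [hve, inner_add_right, real_inner_smul_right, real_inner_smul_right, hue,
      real_inner_self_eq_norm_sq, hu]
    ring
  have hvz : inner ℝ v z = c * inner ℝ u z + s * inner ℝ e z := by
    rw [hve, inner_add_left, real_inner_smul_left, real_inner_smul_left]
  rw [norm_add_sq_real, norm_sub_sq_real, inner_add_left, inner_sub_left, hu, hv, huv, hvz]
  have h3 : (1 : ℝ) ^ 2 + 2 * c + 1 ^ 2 = 2 * (1 + c) := by ring
  have h4 : (1 : ℝ) ^ 2 - 2 * c + 1 ^ 2 = 2 * (1 - c) := by ring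
  rw [h3, h4]
  generalize inner ℝ u z = a
  generalize inner ℝ e z = b
  have h5 : (2 * (1 + c))⁻¹ * (a + (c * a + s * b)) ^ 2 =
      (1 + c) * a ^ 2 / 2 + s * a * b + (1 - c) * b ^ 2 / 2 := by
    field_simp
    linear_combination b ^ 2 * hcs
  have h6 : (2 * (1 - c))⁻¹ * (a - (c * a + s * b)) ^ 2 =
      (1 - c) * a ^ 2 / 2 - s * a * b + (1 + c) * b ^ 2 / 2 := by
    field_simp
    linear_combination b ^ 2 * hcs
  rw [h5, h6]
  ring

/-! ### Nets of the unit sphere and the operator norm -/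

/-- A finite `δ`-net of the unit sphere consisting of unit vectors. -/
structure IsSphereNet {F : Type*} [NormedAddCommGroup F] (δ : ℝ) (N : Finset F) : Prop where
  norm_eq_one : ∀ z ∈ N, ‖z‖ = 1
  exists_near : ∀ x : F, ‖x‖ = 1 → ∃ z ∈ N, ‖x - z‖ ≤ δ

theorem EuclideanSpace.norm_le_sum_abs {k : ℕ} (x : EuclideanSpace ℝ (Fin k)) :
    ‖x‖ ≤ ∑ i, |x i| := by
  rw [EuclideanSpace.norm_eq]
  apply Real.sqrt_le_iff.mpr
  refine ⟨Finset.sum_nonneg fun i _ => abs_nonneg _, ?_⟩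
  simp_rw [Real.norm_eq_abs]
  exact Finset.sum_sq_le_sq_sum_of_nonneg fun i _ => abs_nonneg _

/-- Coordinates are rounded to a grid of mesh `δ / k` and one unit vector is kept per occupied cell;
two vectors in a cell are within `k * (δ / k)` in the sum norm. The factor `k` in the base is cruder
than a volumetric net, but costs only the `log k` that the width hypothesis supplies. -/
theorem exists_sphereNet_euclideanSpace (k : ℕ) {δ : ℝ} (hδ0 : 0 < δ) (hδ1 : δ ≤ 1) :
    ∃ N : Finset (EuclideanSpace ℝ (Fin k)), IsSphereNet δ N ∧ (N.card : ℝ) ≤ (5 * k / δ) ^ k := by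
  classical
  rcases Nat.eq_zero_or_pos k with rfl | hk
  · refine ⟨∅, ⟨by simp, fun x hx => ?_⟩, by simp⟩
    rw [Subsingleton.elim x 0, norm_zero] at hx
    norm_num at hx
  have hk' : (1 : ℝ) ≤ k := by exact_mod_cast hk
  set h : ℝ := δ / k with hh
  have hh0 : 0 < h := by positivity
  set M : ℤ := ⌈(1 / h : ℝ)⌉ with hM
  have hM0 : 0 ≤ M := Int.ceil_nonneg (by positivity)
  set φ : EuclideanSpace ℝ (Fin k) → Fin k → ℤ := fun x i => ⌊x i / h⌋ with hφ
  set T : Finset (Fin k → ℤ) := Fintype.piFinset fun _ => Finset.Icc (-M) M with hT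
  have hφT : ∀ x : EuclideanSpace ℝ (Fin k), ‖x‖ = 1 → φ x ∈ T := by
    intro x hx
    rw [hT, Fintype.mem_piFinset]
    intro i
    have hxi : |x i| ≤ 1 := by
      rw [← hx]
      exact PiLp.norm_apply_le x i
    obtain ⟨h1, h2⟩ := abs_le.mp hxi
    have h3 : x i / h ≤ 1 / h := by gcongr
    have h4 : -(1 / h) ≤ x i / h := by rw [← neg_div]; gcongr
    have h5 : (1 / h : ℝ) ≤ M := Int.le_ceil _
    rw [Finset.mem_Icc]
    constructor
    · apply Int.le_floor.mpr
      push_cast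
      linarith
    · have h6 := Int.floor_le (x i / h)
      have h7 : (⌊x i / h⌋ : ℝ) ≤ M := by linarith
      exact_mod_cast h7
  let P : (Fin k → ℤ) → Prop := fun t => ∃ x : EuclideanSpace ℝ (Fin k), ‖x‖ = 1 ∧ φ x = t
  let rep : (Fin k → ℤ) → EuclideanSpace ℝ (Fin k) := fun t => if ht : P t then ht.choose else 0
  have hrep : ∀ t, P t → ‖rep t‖ = 1 ∧ φ (rep t) = t := by
    intro t ht
    simp only [rep, dif_pos ht]
    exact ht.choose_spec
  refine ⟨(T.filter P).image rep, ⟨?_, ?_⟩, ?_⟩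
  · intro z hz
    obtain ⟨t, ht, rfl⟩ := Finset.mem_image.mp hz
    exact (hrep t (Finset.mem_filter.mp ht).2).1
  · intro x hx
    have hP : P (φ x) := ⟨x, hx, rfl⟩
    refine ⟨rep (φ x), Finset.mem_image_of_mem _ (Finset.mem_filter.mpr ⟨hφT x hx, hP⟩), ?_⟩
    obtain ⟨-, h2⟩ := hrep _ hP
    refine (EuclideanSpace.norm_le_sum_abs _).trans ?_
    have : ∀ i ∈ Finset.univ, |(x - rep (φ x)) i| ≤ h := by
      intro i _
      have h3 : ⌊x i / h⌋ = ⌊rep (φ x) i / h⌋ := (congrFun h2 i).symm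
      have h4 := Int.abs_sub_lt_one_of_floor_eq_floor h3
      rw [← sub_div, abs_div, abs_of_pos hh0, div_lt_one hh0] at h4
      exact h4.le
    refine (Finset.sum_le_sum this).trans ?_
    simp only [Finset.sum_const, Finset.card_univ, Fintype.card_fin, nsmul_eq_mul, hh]
    apply le_of_eq
    field_simp
  · have h1 : ((T.filter P).image rep).card ≤ T.card :=
      Finset.card_image_le.trans (Finset.card_filter_le _ _)
    have h2 : T.card = (2 * M + 1).toNat ^ k := by
      rw [hT, Fintype.card_piFinset_const, Int.card_Icc]
      congr 2
      ring
    have h3 : ((2 * M + 1).toNat : ℝ) ≤ 5 * k / δ := by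
      have h4 : ((2 * M + 1).toNat : ℤ) = 2 * M + 1 := Int.toNat_of_nonneg (by omega)
      have h5 : ((2 * M + 1).toNat : ℝ) = 2 * M + 1 := by exact_mod_cast h4
      have h6 : (M : ℝ) < 1 / h + 1 := Int.ceil_lt_add_one _
      have h7 : (1 / h : ℝ) = k / δ := by rw [hh, one_div_div]
      have h8 : 1 ≤ k / δ := by
        rw [le_div_iff₀ hδ0]
        linarith
      have h9 : 5 * k / δ = 5 * (k / δ) := by ring
      rw [h5, h9]
      linarith
    calc (((T.filter P).image rep).card : ℝ) ≤ T.card := by exact_mod_cast h1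
      _ = ((2 * M + 1).toNat : ℝ) ^ k := by rw [h2]; push_cast; rfl
      _ ≤ _ := by gcongr

section Net

variable {F : Type*} [NormedAddCommGroup F] [InnerProductSpace ℝ F]

theorem exists_sphereNet [FiniteDimensional ℝ F] {r : ℕ} (hr : 0 < r)
    (hF : Module.finrank ℝ F ≤ r) {δ : ℝ} (hδ0 : 0 < δ) (hδ1 : δ ≤ 1) :
    ∃ N : Finset F, IsSphereNet δ N ∧ (N.card : ℝ) ≤ (5 * r / δ) ^ r := by
  classical
  obtain ⟨N, hN, hcard⟩ := exists_sphereNet_euclideanSpace (Module.finrank ℝ F) hδ0 hδ1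
  set e := (stdOrthonormalBasis ℝ F).repr with he
  refine ⟨N.image e.symm, ⟨?_, ?_⟩, ?_⟩
  · intro z hz
    obtain ⟨t, ht, rfl⟩ := Finset.mem_image.mp hz
    rw [LinearIsometryEquiv.norm_map, hN.norm_eq_one t ht]
  · intro x hx
    obtain ⟨z, hz, hxz⟩ := hN.exists_near (e x) (by rw [LinearIsometryEquiv.norm_map, hx])
    refine ⟨e.symm z, Finset.mem_image_of_mem _ hz, ?_⟩
    rw [← e.norm_map, map_sub, e.apply_symm_apply]
    exact hxz
  · have hr' : (1 : ℝ) ≤ r := by exact_mod_cast hr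
    have h1 : 1 ≤ 5 * r / δ := by
      rw [le_div_iff₀ hδ0]
      linarith
    calc ((N.image e.symm).card : ℝ) ≤ N.card := by exact_mod_cast Finset.card_image_le
      _ ≤ (5 * (Module.finrank ℝ F : ℝ) / δ) ^ Module.finrank ℝ F := hcard
      _ ≤ (5 * r / δ) ^ Module.finrank ℝ F := by gcongr
      _ ≤ (5 * r / δ) ^ r := pow_le_pow_right₀ h1 hF

/-- Polarization: let `y` be the multiple of `T x` of length `‖x‖`. Then `4 ‖x‖ ‖T x‖ = 4 ⟪y, T x⟫`
is the difference of the quadratic form at `x + y` and `x - y`, at most `4 b ‖x‖ ^ 2` by the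
parallelogram law. -/
theorem opNorm_le_of_abs_inner_le {T : F →L[ℝ] F} (hT : ∀ x y, inner ℝ (T x) y = inner ℝ x (T y))
    {b : ℝ} (hb : 0 ≤ b) (h : ∀ x, |inner ℝ x (T x)| ≤ b * ‖x‖ ^ 2) : ‖T‖ ≤ b := by
  refine T.opNorm_le_bound hb fun x => ?_
  by_cases hTx : T x = 0
  · rw [hTx, norm_zero]
    positivity
  by_cases hx : x = 0
  · simp [hx]
  have hTx' : 0 < ‖T x‖ := norm_pos_iff.mpr hTx
  have hx' : 0 < ‖x‖ := norm_pos_iff.mpr hx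
  set y : F := (‖x‖ / ‖T x‖) • T x with hy
  have hyn : ‖y‖ = ‖x‖ := by
    rw [hy, norm_smul, Real.norm_of_nonneg (by positivity)]
    field_simp
  have hyT : inner ℝ y (T x) = ‖x‖ * ‖T x‖ := by
    rw [hy, real_inner_smul_left, real_inner_self_eq_norm_sq]
    field_simp
  have h1 := (abs_le.mp (h (x + y))).2
  have h2 := (abs_le.mp (h (x - y))).1
  have h3 : inner ℝ (x + y) (T (x + y)) - inner ℝ (x - y) (T (x - y)) = 4 * inner ℝ y (T x) := by
    have : inner ℝ x (T y) = inner ℝ y (T x) := by rw [← hT, real_inner_comm]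
    simp only [map_add, map_sub, inner_add_left, inner_add_right, inner_sub_left, inner_sub_right,
      this]
    ring
  have h4 : ‖x + y‖ ^ 2 + ‖x - y‖ ^ 2 = 4 * ‖x‖ ^ 2 := by
    rw [norm_add_sq_real, norm_sub_sq_real, hyn]
    ring
  rw [hyT] at h3
  have h5 : ‖x‖ * ‖T x‖ ≤ ‖x‖ * (b * ‖x‖) := by nlinarith
  exact le_of_mul_le_mul_left h5 hx'

/-- Moving a unit vector to the net changes the quadratic form by at most `2 * (1/4) * ‖T‖`, so `‖T‖
≤ b + ‖T‖ / 2`. -/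
theorem opNorm_le_of_sphereNet {T : F →L[ℝ] F} (hT : ∀ x y, inner ℝ (T x) y = inner ℝ x (T y))
    {N : Finset F} {δ : ℝ} (hδ : δ ≤ 1 / 4) (hN : IsSphereNet δ N) {b : ℝ} (hb : 0 ≤ b)
    (h : ∀ z ∈ N, |inner ℝ z (T z)| ≤ b) : ‖T‖ ≤ 2 * b := by
  have hunit : ∀ x, ‖x‖ = 1 → |inner ℝ x (T x)| ≤ b + ‖T‖ / 2 := by
    intro x hx
    obtain ⟨z, hz, hxz⟩ := hN.exists_near x hx
    have hz1 := hN.norm_eq_one z hz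
    have h1 : inner ℝ x (T x) =
        inner ℝ z (T z) + (inner ℝ (x - z) (T x) + inner ℝ z (T (x - z))) := by
      simp only [map_sub, inner_sub_left, inner_sub_right]
      ring
    have h2 : |inner ℝ (x - z) (T x)| ≤ 1 / 4 * ‖T‖ := by
      refine (abs_real_inner_le_norm _ _).trans ?_
      have := T.le_opNorm x
      rw [hx, mul_one] at this
      gcongr
      exact hxz.trans hδ
    have h3 : |inner ℝ z (T (x - z))| ≤ 1 / 4 * ‖T‖ := by
      refine (abs_real_inner_le_norm _ _).trans ?_
      rw [hz1, one_mul]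
      refine (T.le_opNorm _).trans ?_
      rw [mul_comm]
      gcongr
      exact hxz.trans hδ
    rw [h1]
    refine (abs_add_le _ _).trans ?_
    have := (abs_add_le (inner ℝ (x - z) (T x)) (inner ℝ z (T (x - z))))
    linarith [h z hz]
  have hall : ∀ x, |inner ℝ x (T x)| ≤ (b + ‖T‖ / 2) * ‖x‖ ^ 2 := by
    intro x
    by_cases hx : x = 0
    · simp [hx]
    have hx' : 0 < ‖x‖ := norm_pos_iff.mpr hx
    have h1 := hunit (‖x‖⁻¹ • x) (by simp [norm_smul, hx'.ne'])
    rw [map_smul, real_inner_smul_left, real_inner_smul_right, abs_mul, abs_mul,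
      abs_of_pos (inv_pos.mpr hx')] at h1
    calc |inner ℝ x (T x)| = (‖x‖⁻¹ * (‖x‖⁻¹ * |inner ℝ x (T x)|)) * ‖x‖ ^ 2 := by field_simp
      _ ≤ _ := by gcongr
  have := opNorm_le_of_abs_inner_le hT (by positivity) hall
  linarith

end Net

/-! ### The Weight Distribution Condition for Gaussian matrices -/

section Forms

variable {E : Type*} [NormedAddCommGroup E] [InnerProductSpace ℝ E]

/-- `⟪z, g⟫²` on the sector where `⟪x, g⟫` and `⟪y, g⟫` are positive. -/
noncomputable def activeSq (x y z g : E) : ℝ :=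
  if 0 < inner ℝ x g ∧ 0 < inner ℝ y g then (inner ℝ z g) ^ 2 else 0

/-- `⟪z, g⟫²` on the slab where `|⟪x, g⟫| ≤ η`. -/
noncomputable def slabSq (η : ℝ) (x z g : E) : ℝ :=
  {g | |inner ℝ x g| ≤ η}.indicator (fun g => (inner ℝ z g) ^ 2) g

/-- `⟪z, g⟫²` outside of the slab where `|⟪x, g⟫| ≤ η`. -/
noncomputable def farSq (η : ℝ) (x z g : E) : ℝ :=
  {g | η < |inner ℝ x g|}.indicator (fun g => (inner ℝ z g) ^ 2) g

theorem activeSq_nonneg (x y z g : E) : 0 ≤ activeSq x y z g := by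
  unfold activeSq
  split_ifs <;> positivity

theorem slabSq_nonneg (η : ℝ) (x z g : E) : 0 ≤ slabSq η x z g :=
  Set.indicator_nonneg (fun _ _ => sq_nonneg _) _

theorem farSq_nonneg (η : ℝ) (x z g : E) : 0 ≤ farSq η x z g :=
  Set.indicator_nonneg (fun _ _ => sq_nonneg _) _

theorem abs_activeSq_le (x y z g : E) : |activeSq x y z g| ≤ (inner ℝ z g) ^ 2 := by
  rw [abs_of_nonneg (activeSq_nonneg x y z g), activeSq]
  split_ifs
  · exact le_rfl
  · positivity

theorem abs_slabSq_le (η : ℝ) (x z g : E) : |slabSq η x z g| ≤ (inner ℝ z g) ^ 2 := by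
  rw [abs_of_nonneg (slabSq_nonneg η x z g)]
  exact Set.indicator_le_self' (fun _ _ => sq_nonneg _) _

theorem abs_farSq_le (η : ℝ) (x z g : E) : |farSq η x z g| ≤ (inner ℝ z g) ^ 2 := by
  rw [abs_of_nonneg (farSq_nonneg η x z g)]
  exact Set.indicator_le_self' (fun _ _ => sq_nonneg _) _

theorem inner_pos_iff_of_far {η : ℝ} {x x₀ g : E} (h1 : η < |inner ℝ x₀ g|)
    (h2 : |inner ℝ (x - x₀) g| ≤ η) : 0 < inner ℝ x g ↔ 0 < inner ℝ x₀ g := by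
  rw [inner_sub_left] at h2
  obtain ⟨h3, h4⟩ := abs_le.mp h2
  rcases lt_abs.mp h1 with h | h
  · constructor <;> intro <;> linarith
  · constructor <;> intro <;> linarith

/-- The indicators can change only if `g` is within `η` of one of the two reference hyperplanes, or
if a displacement moves an inner product by more than `η`. -/
theorem abs_activeSq_sub_le (η : ℝ) (x x₀ y y₀ z g : E) :
    |activeSq x y z g - activeSq x₀ y₀ z g| ≤
      slabSq η x₀ z g + slabSq η y₀ z g + (farSq η (x - x₀) z g + farSq η (y - y₀) z g) := by
  have hbound : |activeSq x y z g - activeSq x₀ y₀ z g| ≤ (inner ℝ z g) ^ 2 := by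
    have h1 := abs_activeSq_le x y z g
    have h2 := abs_activeSq_le x₀ y₀ z g
    rw [abs_of_nonneg (activeSq_nonneg _ _ _ _)] at h1 h2
    rw [abs_le]
    constructor <;> linarith [activeSq_nonneg x y z g, activeSq_nonneg x₀ y₀ z g]
  have p1 := slabSq_nonneg η x₀ z g
  have p2 := slabSq_nonneg η y₀ z g
  have p3 := farSq_nonneg η (x - x₀) z g
  have p4 := farSq_nonneg η (y - y₀) z g
  by_cases h1 : |inner ℝ x₀ g| ≤ η
  · have : slabSq η x₀ z g = (inner ℝ z g) ^ 2 :=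
      Set.indicator_of_mem (s := {g | |inner ℝ x₀ g| ≤ η}) h1 _
    linarith
  by_cases h2 : |inner ℝ y₀ g| ≤ η
  · have : slabSq η y₀ z g = (inner ℝ z g) ^ 2 :=
      Set.indicator_of_mem (s := {g | |inner ℝ y₀ g| ≤ η}) h2 _
    linarith
  by_cases h3 : η < |inner ℝ (x - x₀) g|
  · have : farSq η (x - x₀) z g = (inner ℝ z g) ^ 2 :=
      Set.indicator_of_mem (s := {g | η < |inner ℝ (x - x₀) g|}) h3 _
    linarith
  by_cases h4 : η < |inner ℝ (y - y₀) g|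
  · have : farSq η (y - y₀) z g = (inner ℝ z g) ^ 2 :=
      Set.indicator_of_mem (s := {g | η < |inner ℝ (y - y₀) g|}) h4 _
    linarith
  push Not at h1 h2 h3 h4
  have : activeSq x y z g = activeSq x₀ y₀ z g := by
    simp only [activeSq, inner_pos_iff_of_far h1 h3, inner_pos_iff_of_far h2 h4]
  rw [this, sub_self, abs_zero]
  positivity

variable [FiniteDimensional ℝ E] [MeasurableSpace E] [BorelSpace E]

theorem measurable_activeSq (x y z : E) : Measurable (activeSq x y z) := by
  refine Measurable.ite ?_ (by fun_prop) (by fun_prop)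
  rw [Set.ofPred_and]
  exact (measurableSet_lt (by fun_prop) (by fun_prop)).inter
    (measurableSet_lt (by fun_prop) (by fun_prop))

theorem measurableSet_slab (η : ℝ) (x : E) : MeasurableSet {g : E | |inner ℝ x g| ≤ η} :=
  measurableSet_le (by fun_prop) (by fun_prop)

theorem measurableSet_far (η : ℝ) (x : E) : MeasurableSet {g : E | η < |inner ℝ x g|} :=
  measurableSet_lt (by fun_prop) (by fun_prop)

theorem measurable_slabSq (η : ℝ) (x z : E) : Measurable (slabSq η x z) :=
  Measurable.indicator (by fun_prop) (measurableSet_slab η x)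

theorem measurable_farSq (η : ℝ) (x z : E) : Measurable (farSq η x z) :=
  Measurable.indicator (by fun_prop) (measurableSet_far η x)

theorem integral_slabSq_le {τ : ℝ} (hτ : 0 < τ) {x z : E} (hx : ‖x‖ = 1) (hz : ‖z‖ = 1) :
    ∫ g, slabSq (τ ^ 2) x z g ∂(stdGaussian E) ≤ 25 * τ :=
  setIntegral_inner_sq_le hz (measurableSet_slab _ x) hτ
    (stdGaussian_real_abs_inner_le hx (by positivity))

/-- Chebyshev gives probability at most `τ ^ 6 / τ ^ 4 = τ ^ 2`, the same as for the slab; this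
dictates the scale `τ ^ 3` for displacements. -/
theorem integral_farSq_le {τ : ℝ} (hτ : 0 < τ) {v z : E} (hv : ‖v‖ ≤ τ ^ 3) (hz : ‖z‖ = 1) :
    ∫ g, farSq (τ ^ 2) v z g ∂(stdGaussian E) ≤ 25 * τ := by
  refine setIntegral_inner_sq_le hz (measurableSet_far _ v) hτ
    ((stdGaussian_real_lt_abs_inner_le v (by positivity)).trans ?_)
  calc ‖v‖ ^ 2 / (τ ^ 2) ^ 2 ≤ (τ ^ 3) ^ 2 / (τ ^ 2) ^ 2 := by gcongr
    _ = τ ^ 2 := by field_simp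

theorem abs_integral_activeSq_sub_le {τ : ℝ} (hτ : 0 < τ) {x x₀ y y₀ z : E} (hx₀ : ‖x₀‖ = 1)
    (hy₀ : ‖y₀‖ = 1) (hz : ‖z‖ = 1) (hx : ‖x - x₀‖ ≤ τ ^ 3) (hy : ‖y - y₀‖ ≤ τ ^ 3) :
    |∫ g, activeSq x y z g ∂(stdGaussian E) - ∫ g, activeSq x₀ y₀ z g ∂(stdGaussian E)| ≤
      100 * τ := by
  have ia : ∀ x y : E, Integrable (activeSq x y z) (stdGaussian E) := fun x y =>
    integrable_of_abs_le_inner_sq hz (measurable_activeSq x y z) (abs_activeSq_le x y z)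
  have is : ∀ x : E, Integrable (slabSq (τ ^ 2) x z) (stdGaussian E) := fun x =>
    integrable_of_abs_le_inner_sq hz (measurable_slabSq _ x z) (abs_slabSq_le _ x z)
  have ig : ∀ x : E, Integrable (farSq (τ ^ 2) x z) (stdGaussian E) := fun x =>
    integrable_of_abs_le_inner_sq hz (measurable_farSq _ x z) (abs_farSq_le _ x z)
  have i1 : Integrable (fun g => slabSq (τ ^ 2) x₀ z g + slabSq (τ ^ 2) y₀ z g)
    (stdGaussian E) := (is x₀).add (is y₀)
  have i2 : Integrable (fun g => farSq (τ ^ 2) (x - x₀) z g + farSq (τ ^ 2) (y - y₀) z g)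
    (stdGaussian E) := (ig _).add (ig _)
  rw [← integral_sub (ia x y) (ia x₀ y₀)]
  refine abs_integral_le_integral_abs.trans ?_
  calc ∫ g, |activeSq x y z g - activeSq x₀ y₀ z g| ∂(stdGaussian E)
      ≤ ∫ g, (slabSq (τ ^ 2) x₀ z g + slabSq (τ ^ 2) y₀ z g + (farSq (τ ^ 2) (x - x₀) z g +
          farSq (τ ^ 2) (y - y₀) z g)) ∂(stdGaussian E) :=
        integral_mono ((ia x y).sub (ia x₀ y₀)).abs (i1.add i2)
          fun g => abs_activeSq_sub_le _ x x₀ y y₀ z g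
    _ ≤ 100 * τ := by
        rw [integral_add i1 i2, integral_add (is _) (is _), integral_add (ig _) (ig _)]
        linarith [integral_slabSq_le hτ hx₀ hz, integral_slabSq_le hτ hy₀ hz,
          integral_farSq_le hτ hx hz, integral_farSq_le hτ hy hz]

/-- Uniform approximation of the empirical active form from its approximation on a net. -/
theorem abs_mean_activeSq_sub_le {n : ℕ} {G : Fin n → E} {N : Finset E}
    {τ t δ R : ℝ} (hτ : 0 < τ) (hN : IsSphereNet δ N) (hδ : δ ≤ τ ^ 3)
    (hδR : δ * R ≤ τ ^ 2) (hR : ∀ i, ‖G i‖ ≤ R)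
    (hactive : ∀ x ∈ N, ∀ y ∈ N, ∀ z ∈ N,
      |(n : ℝ)⁻¹ * ∑ i, activeSq x y z (G i) - ∫ g, activeSq x y z g ∂(stdGaussian E)| ≤ t)
    (hslab : ∀ x ∈ N, ∀ z ∈ N, |(n : ℝ)⁻¹ * ∑ i, slabSq (τ ^ 2) x z (G i) -
      ∫ g, slabSq (τ ^ 2) x z g ∂(stdGaussian E)| ≤ t)
    {x y z : E} (hx : ‖x‖ = 1) (hy : ‖y‖ = 1) (hz : z ∈ N) :
    |(n : ℝ)⁻¹ * ∑ i, activeSq x y z (G i) - ∫ g, activeSq x y z g ∂(stdGaussian E)| ≤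
      3 * t + 150 * τ := by
  obtain ⟨x₀, hx₀, hxx⟩ := hN.exists_near x hx
  obtain ⟨y₀, hy₀, hyy⟩ := hN.exists_near y hy
  have nx := hN.norm_eq_one x₀ hx₀
  have ny := hN.norm_eq_one y₀ hy₀
  have nz := hN.norm_eq_one z hz
  -- For the sample, bounded rows exclude large displacements outright, leaving only slab terms: `2
  -- * t + 50 * τ`. The comparison of expectations costs `100 * τ` and the deviation at the net
  -- point costs `t`.
  have hfar : ∀ v : E, ‖v‖ ≤ δ → ∀ i, farSq (τ ^ 2) v z (G i) = 0 := by
    intro v hv i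
    refine Set.indicator_of_notMem ?_ _
    simp only [Set.mem_ofPred_eq, not_lt]
    refine (abs_real_inner_le_norm _ _).trans (le_trans ?_ hδR)
    gcongr
    · exact (norm_nonneg v).trans hv
    · exact hR i
  have h1 := abs_integral_activeSq_sub_le hτ nx ny nz (hxx.trans hδ) (hyy.trans hδ)
  have h2 := hactive x₀ hx₀ y₀ hy₀ z hz
  have h3 : |(n : ℝ)⁻¹ * ∑ i, activeSq x y z (G i) - (n : ℝ)⁻¹ * ∑ i, activeSq x₀ y₀ z (G i)| ≤
      2 * t + 50 * τ := by
    rw [← mul_sub, ← Finset.sum_sub_distrib, abs_mul, abs_of_nonneg (by positivity)]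
    calc (n : ℝ)⁻¹ * |∑ i, (activeSq x y z (G i) - activeSq x₀ y₀ z (G i))|
        ≤ (n : ℝ)⁻¹ * ∑ i, (slabSq (τ ^ 2) x₀ z (G i) + slabSq (τ ^ 2) y₀ z (G i)) := by
          gcongr
          refine (Finset.abs_sum_le_sum_abs _ _).trans (Finset.sum_le_sum fun i _ => ?_)
          have h := abs_activeSq_sub_le (τ ^ 2) x x₀ y y₀ z (G i)
          rwa [hfar _ hxx i, hfar _ hyy i, add_zero, add_zero] at h
      _ = (n : ℝ)⁻¹ * ∑ i, slabSq (τ ^ 2) x₀ z (G i) +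
            (n : ℝ)⁻¹ * ∑ i, slabSq (τ ^ 2) y₀ z (G i) := by
          rw [Finset.sum_add_distrib, mul_add]
      _ ≤ _ := by
          linarith [(abs_le.mp (hslab x₀ hx₀ z hz)).2, (abs_le.mp (hslab y₀ hy₀ z hz)).2,
            integral_slabSq_le hτ nx nz, integral_slabSq_le hτ ny nz]
  rw [abs_le] at h1 h2 h3 ⊢
  constructor <;> linarith [h1.1, h1.2, h2.1, h2.2, h3.1, h3.2]

end Forms

/-- The matrix whose rows are `n^{-1/2}` times the given vectors. -/
noncomputable def matrixOfRows {n k : ℕ} (G : Fin n → EuclideanSpace ℝ (Fin k)) :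
    Matrix (Fin n) (Fin k) ℝ :=
  Matrix.of fun i j => (√n)⁻¹ * G i j

theorem matrixOfRows_dotProduct {n k : ℕ} (G : Fin n → EuclideanSpace ℝ (Fin k)) (i : Fin n)
    (x : EuclideanSpace ℝ (Fin k)) :
    matrixOfRows G i ⬝ᵥ x.ofLp = (√n)⁻¹ * inner ℝ x (G i) := by
  simp only [matrixOfRows, dotProduct, Matrix.of_apply, PiLp.inner_apply, Finset.mul_sum]
  refine Finset.sum_congr rfl fun j _ => ?_
  simp
  ring

theorem inner_activeGram_matrixOfRows {n k : ℕ} (G : Fin n → EuclideanSpace ℝ (Fin k))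
    (x y z : EuclideanSpace ℝ (Fin k)) :
    inner ℝ z (WithLp.toLp 2 (activeGram (matrixOfRows G) x y *ᵥ z.ofLp)) =
      (n : ℝ)⁻¹ * ∑ i, activeSq x y z (G i) := by
  rw [activeGram, Matrix.sum_mulVec, WithLp.toLp_sum, inner_sum, Finset.mul_sum]
  refine Finset.sum_congr rfl fun i _ => ?_
  have hn : 0 < (√(n : ℝ))⁻¹ := by
    have : 0 < n := i.pos
    positivity
  simp only [matrixOfRows_dotProduct, mul_pos_iff_of_pos_left hn, activeSq]
  split_ifs
  · rw [Matrix.vecMulVec_mulVec, matrixOfRows_dotProduct]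
    have h : ∀ c : ℝ, inner ℝ z (WithLp.toLp 2 (MulOpposite.op c • matrixOfRows G i)) =
        c * (matrixOfRows G i ⬝ᵥ z.ofLp) := by
      intro c
      simp [PiLp.inner_apply, dotProduct, Finset.mul_sum]
      refine Finset.sum_congr rfl fun j _ => ?_
      ring
    rw [h, matrixOfRows_dotProduct]
    have h2 : (√(n : ℝ))⁻¹ * (√(n : ℝ))⁻¹ = (n : ℝ)⁻¹ := by
      rw [← mul_inv, Real.mul_self_sqrt (by positivity)]
    rw [← h2]
    ring
  · simp

theorem activeGram_isHermitian {n k : ℕ} (W : Matrix (Fin n) (Fin k) ℝ)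
    (x y : EuclideanSpace ℝ (Fin k)) : (activeGram W x y).IsHermitian := by
  rw [Matrix.IsHermitian, activeGram, Matrix.conjTranspose_sum]
  refine Finset.sum_congr rfl fun i _ => ?_
  split_ifs
  · simp
  · simp

theorem Qmat_isHermitian {k : ℕ} (x y : EuclideanSpace ℝ (Fin k)) : (Qmat x y).IsHermitian := by
  simp [Matrix.IsHermitian, Qmat, swapMatrix, lineProj]

/-- The WDC follows from norm bounds on the rows and concentration on a net. -/
theorem WDC_matrixOfRows {n k : ℕ} (hk : 2 ≤ k) {G : Fin n → EuclideanSpace ℝ (Fin k)}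
    {N : Finset (EuclideanSpace ℝ (Fin k))} {τ t δ R : ℝ} (hτ : 0 < τ) (ht : 0 ≤ t)
    (hN : IsSphereNet δ N) (hδ4 : δ ≤ 1 / 4) (hδ : δ ≤ τ ^ 3) (hδR : δ * R ≤ τ ^ 2)
    (hR : ∀ i, ‖G i‖ ≤ R)
    (hactive : ∀ x ∈ N, ∀ y ∈ N, ∀ z ∈ N, |(n : ℝ)⁻¹ * ∑ i, activeSq x y z (G i) -
      ∫ g, activeSq x y z g ∂(stdGaussian (EuclideanSpace ℝ (Fin k)))| ≤ t)
    (hslab : ∀ x ∈ N, ∀ z ∈ N, |(n : ℝ)⁻¹ * ∑ i, slabSq (τ ^ 2) x z (G i) -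
      ∫ g, slabSq (τ ^ 2) x z g ∂(stdGaussian (EuclideanSpace ℝ (Fin k)))| ≤ t) :
    WDC (matrixOfRows G) (2 * (3 * t + 150 * τ)) := by
  intro x y hx hy
  have hsa : IsSelfAdjoint
      (Matrix.toEuclideanCLM (𝕜 := ℝ) (activeGram (matrixOfRows G) x y - Qmat x y)) :=
    IsSelfAdjoint.map (Matrix.isHermitian_iff_isSelfAdjoint.mp
      ((activeGram_isHermitian _ x y).sub (Qmat_isHermitian x y))) Matrix.toEuclideanCLM
  refine opNorm_le_of_sphereNet
    (ContinuousLinearMap.isSelfAdjoint_iff_isSymmetric.mp hsa) hδ4 hN (by positivity) ?_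
  intro z hz
  have hx' : 0 < ‖x‖⁻¹ := inv_pos.mpr (norm_pos_iff.mpr hx)
  have hy' : 0 < ‖y‖⁻¹ := inv_pos.mpr (norm_pos_iff.mpr hy)
  have hnorm : ∀ g, activeSq x y z g = activeSq (normalized x) (normalized y) z g := by
    intro g
    simp only [activeSq, normalized, real_inner_smul_left, mul_pos_iff_of_pos_left hx',
      mul_pos_iff_of_pos_left hy']
  have h := abs_mean_activeSq_sub_le hτ hN hδ hδR hR hactive hslab (norm_normalized hx)
    (norm_normalized hy) hz
  simp_rw [← hnorm] at h
  have hQ : ∫ g, activeSq x y z g ∂(stdGaussian (EuclideanSpace ℝ (Fin k))) = _ :=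
    integral_active_eq_inner_Qmat hk hx hy z
  rw [← inner_activeGram_matrixOfRows, hQ, ← inner_sub_right, ← WithLp.toLp_sub,
    ← Matrix.sub_mulVec] at h
  exact h

theorem half_le_log {k : ℕ} (hk : 2 ≤ k) : 1 / 2 ≤ Real.log k := by
  have h1 : Real.log 2 ≤ Real.log k := Real.log_le_log (by norm_num) (by exact_mod_cast hk)
  linarith [Real.log_two_gt_d9]

theorem pi_stdGaussian_real_exists_norm_gt_le (n k : ℕ) :
    (Measure.pi fun _ : Fin n => stdGaussian (EuclideanSpace ℝ (Fin k))).real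
      (⋃ i : Fin n, {G | 8 * (k : ℝ) ≤ ‖G i‖ ^ 2}) ≤ n * Real.exp (-k) := by
  refine (measureReal_iUnion_fintype_le _).trans ?_
  have h : ∀ i : Fin n, (Measure.pi fun _ : Fin n => stdGaussian (EuclideanSpace ℝ (Fin k))).real
      {G | 8 * (k : ℝ) ≤ ‖G i‖ ^ 2} ≤ Real.exp (-k) := by
    intro i
    have hm : MeasurableSet {g : EuclideanSpace ℝ (Fin k) | 8 * (k : ℝ) ≤ ‖g‖ ^ 2} :=
      measurableSet_le (by fun_prop) (by fun_prop)
    exact ((measurePreserving_eval (fun _ : Fin n => stdGaussian (EuclideanSpace ℝ (Fin k)))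
      i).measureReal_preimage hm.nullMeasurableSet).trans_le (stdGaussian_real_norm_sq_ge k)
  refine (Finset.sum_le_sum fun i _ => h i).trans ?_
  simp

/-- The logarithm of `c ^ 3` is at most `246 τ⁻³ k log k`, of order `ε⁻³`, while `t ^ 2` costs two
more powers of `ε`: hence the fifth power. The exponent is at least twice this logarithm, and the
remaining half still exceeds `k`. -/
theorem net_card_pow_mul_exp_le {k n : ℕ} (hk : 2 ≤ k) {ε τ t : ℝ} (hε0 : 0 < ε) (hε1 : ε < 1)
    (hτ : τ = ε / 600) (ht : t = ε / 12)
    (hn : 10 ^ 17 * ε⁻¹ ^ 5 * k * Real.log k ≤ n) {c : ℝ} (hc0 : 0 ≤ c)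
    (hc : c ≤ (5 * k / (τ ^ 3 / (8 * k))) ^ k) :
    c ^ 3 * Real.exp (-(n * t ^ 2 / 800)) ≤ Real.exp (-k) := by
  have hk' : (2 : ℝ) ≤ k := by exact_mod_cast hk
  have hL := half_le_log hk
  set L := Real.log k with hLdef
  have hτ0 : 0 < τ := by rw [hτ]; positivity
  have hτ1 : τ ≤ 1 := by rw [hτ]; linarith
  have hτ3 : τ ^ 3 ≤ 1 := pow_le_one₀ hτ0.le hτ1
  have hτinv : 1 ≤ (τ ^ 3)⁻¹ := (one_le_inv₀ (by positivity)).mpr hτ3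
  have hbase : 5 * k / (τ ^ 3 / (8 * k)) = 40 * (τ ^ 3)⁻¹ * (k : ℝ) ^ 2 := by
    field_simp
    ring
  have hlog : Real.log (40 * (τ ^ 3)⁻¹ * (k : ℝ) ^ 2) ≤ 82 * (τ ^ 3)⁻¹ * L := by
    rw [Real.log_mul (by positivity) (by positivity), Real.log_pow]
    have h1 := Real.log_le_sub_one_of_pos (x := 40 * (τ ^ 3)⁻¹) (by positivity)
    push_cast
    nlinarith
  have hc' : c ≤ Real.exp (k * (82 * (τ ^ 3)⁻¹ * L)) := by
    refine hc.trans ?_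
    rw [hbase, Real.exp_nat_mul]
    gcongr
    rwa [← Real.log_le_iff_le_exp (by positivity)]
  have hε5 : ε⁻¹ ^ 5 * ε ^ 2 = ε⁻¹ ^ 3 := by
    field_simp
  have hτε : (τ ^ 3)⁻¹ = 600 ^ 3 * ε⁻¹ ^ 3 := by
    rw [hτ]
    field_simp
  have hmain : 2 * (246 * (τ ^ 3)⁻¹ * (k * L)) ≤ n * t ^ 2 / 800 := by
    have h1 : 10 ^ 17 * ε⁻¹ ^ 5 * k * L * ε ^ 2 ≤ n * ε ^ 2 := by gcongr
    have h2 : 10 ^ 17 * ε⁻¹ ^ 5 * k * L * ε ^ 2 = 10 ^ 17 * (ε⁻¹ ^ 3 * (k * L)) := by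
      rw [← hε5]
      ring
    rw [h2] at h1
    rw [hτε, ht]
    have h3 : 0 ≤ ε⁻¹ ^ 3 * (k * L) := by positivity
    nlinarith
  have hkL : (k : ℝ) ≤ 246 * (τ ^ 3)⁻¹ * (k * L) := by
    have h1 : 1 / 2 * 1 ≤ L * (τ ^ 3)⁻¹ := by gcongr
    nlinarith
  calc c ^ 3 * Real.exp (-(n * t ^ 2 / 800))
      ≤ Real.exp (k * (82 * (τ ^ 3)⁻¹ * L)) ^ 3 *
          Real.exp (-(2 * (246 * (τ ^ 3)⁻¹ * (k * L)))) := by gcongr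
    _ = Real.exp (-(246 * (τ ^ 3)⁻¹ * (k * L))) := by
        rw [← Real.exp_nat_mul, ← Real.exp_add]
        congr 1
        push_cast
        ring
    _ ≤ Real.exp (-k) := by gcongr

/-- The failure sources are a long row (`n e^{-k}`), a deviating active sum and a deviating slab sum
on the net (`2 e^{-k}` each). -/
theorem pi_stdGaussian_real_not_WDC_le {k n : ℕ} (hk : 2 ≤ k) {ε : ℝ} (hε0 : 0 < ε) (hε1 : ε < 1)
    (hn : 10 ^ 17 * ε⁻¹ ^ 5 * k * Real.log k ≤ n) :
    (Measure.pi fun _ : Fin n => stdGaussian (EuclideanSpace ℝ (Fin k))).real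
      {G | ¬ WDC (matrixOfRows G) ε} ≤ 5 * n * Real.exp (-k) := by
  classical
  have hk' : (2 : ℝ) ≤ k := by exact_mod_cast hk
  have hn0 : 0 < n := by
    have hL := half_le_log hk
    have : (0 : ℝ) < n := lt_of_lt_of_le (by positivity) hn
    exact_mod_cast this
  -- The two choices split `2 * (3 * t + 150 * τ)` into `ε / 2 + ε / 2`.
  obtain ⟨τ, hτ⟩ : ∃ τ, τ = ε / 600 := ⟨_, rfl⟩
  obtain ⟨t, ht⟩ : ∃ t, t = ε / 12 := ⟨_, rfl⟩
  have hτ0 : 0 < τ := by rw [hτ]; positivity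
  have hτ1 : τ ≤ 1 := by rw [hτ]; linarith
  have ht0 : 0 ≤ t := by rw [ht]; positivity
  have ht1 : t ≤ 1 := by rw [ht]; linarith
  have hτ3 : τ ^ 3 ≤ 1 := pow_le_one₀ hτ0.le hτ1
  -- Fine enough both for the expectations (`δ ≤ τ ^ 3`) and for rows of length up to `√(8k)` (`δ *
  -- √(8k) ≤ τ ^ 2`).
  set δ : ℝ := τ ^ 3 / (8 * k) with hδ
  have hδ0 : 0 < δ := by positivity
  have hδτ : δ ≤ τ ^ 3 := div_le_self (by positivity) (by linarith)
  have hδ4 : δ ≤ 1 / 4 := by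
    rw [hδ, div_le_iff₀ (by positivity)]
    linarith
  have hδR : δ * √(8 * k) ≤ τ ^ 2 := by
    have h1 : √(8 * (k : ℝ)) ≤ 8 * k := Real.sqrt_le_iff.mpr ⟨by positivity, by nlinarith⟩
    calc δ * √(8 * k) ≤ δ * (8 * k) := by gcongr
      _ = τ ^ 2 * τ := by rw [hδ]; field_simp
      _ ≤ τ ^ 2 := mul_le_of_le_one_right (by positivity) hτ1
  obtain ⟨N, hN, hcard⟩ := exists_sphereNet_euclideanSpace k hδ0 (by linarith)
  set P := Measure.pi fun _ : Fin n => stdGaussian (EuclideanSpace ℝ (Fin k)) with hP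
  set U₁ : Set (Fin n → EuclideanSpace ℝ (Fin k)) := ⋃ i : Fin n, {G | 8 * (k : ℝ) ≤ ‖G i‖ ^ 2}
    with hU₁
  set U₂ : Set (Fin n → EuclideanSpace ℝ (Fin k)) := ⋃ p ∈ N ×ˢ N ×ˢ N,
    {G | t < |(n : ℝ)⁻¹ * ∑ i, activeSq p.1 p.2.1 p.2.2 (G i) -
      ∫ g, activeSq p.1 p.2.1 p.2.2 g ∂(stdGaussian (EuclideanSpace ℝ (Fin k)))|} with hU₂
  set U₃ : Set (Fin n → EuclideanSpace ℝ (Fin k)) := ⋃ p ∈ N ×ˢ N,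
    {G | t < |(n : ℝ)⁻¹ * ∑ i, slabSq (τ ^ 2) p.1 p.2 (G i) -
      ∫ g, slabSq (τ ^ 2) p.1 p.2 g ∂(stdGaussian (EuclideanSpace ℝ (Fin k)))|} with hU₃
  have hsub : {G | ¬ WDC (matrixOfRows G) ε} ⊆ U₁ ∪ U₂ ∪ U₃ := by
    intro G hG
    by_contra hbad
    simp only [hU₁, hU₂, hU₃, Set.mem_union, Set.mem_iUnion, Set.mem_ofPred_eq, not_or, not_exists,
      not_le, not_lt, Finset.mem_product, Prod.forall] at hbad
    obtain ⟨⟨h1, h2⟩, h3⟩ := hbad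
    apply hG
    have h := WDC_matrixOfRows hk hτ0 ht0 hN hδ4 hδτ hδR
      (fun i => Real.le_sqrt_of_sq_le (h1 i).le)
      (fun x hx y hy z hz => h2 x y z ⟨hx, hy, hz⟩) (fun x hx z hz => h3 x z ⟨hx, hz⟩)
    have hε : 2 * (3 * t + 150 * τ) = ε := by
      rw [ht, hτ]
      ring
    rwa [hε] at h
  have hconc := net_card_pow_mul_exp_le hk hε0 hε1 hτ ht hn (Nat.cast_nonneg N.card) hcard
  have hm2 : P.real U₂ ≤ 2 * Real.exp (-k) := by
    refine (measureReal_biUnion_finset_le _ _).trans ?_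
    refine (Finset.sum_le_sum fun p hp => pi_stdGaussian_real_le_abs_mean_sub hn0
      (hN.norm_eq_one p.2.2 (Finset.mem_product.mp (Finset.mem_product.mp hp).2).2)
      (measurable_activeSq _ _ _) (abs_activeSq_le _ _ _) ht0 ht1).trans ?_
    rw [Finset.sum_const, Finset.card_product, Finset.card_product, nsmul_eq_mul]
    push_cast
    linarith
  have hm3 : P.real U₃ ≤ 2 * Real.exp (-k) := by
    refine (measureReal_biUnion_finset_le _ _).trans ?_
    refine (Finset.sum_le_sum fun p hp => pi_stdGaussian_real_le_abs_mean_sub hn0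
      (hN.norm_eq_one p.2 (Finset.mem_product.mp hp).2)
      (measurable_slabSq _ _ _) (abs_slabSq_le _ _ _) ht0 ht1).trans ?_
    rw [Finset.sum_const, Finset.card_product, nsmul_eq_mul]
    have hsq : N.card * N.card ≤ N.card ^ 3 := by
      rw [← sq]
      rcases Nat.eq_zero_or_pos N.card with h | h
      · simp [h]
      · exact Nat.pow_le_pow_right h (by norm_num)
    have hsq' : ((N.card * N.card : ℕ) : ℝ) ≤ (N.card : ℝ) ^ 3 := by exact_mod_cast hsq
    calc ((N.card * N.card : ℕ) : ℝ) * (2 * Real.exp (-(n * t ^ 2 / 800)))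
        ≤ (N.card : ℝ) ^ 3 * (2 * Real.exp (-(n * t ^ 2 / 800))) := by gcongr
      _ ≤ _ := by linarith
  have hn1 : (1 : ℝ) ≤ n := by exact_mod_cast hn0
  have hexp := Real.exp_pos (-(k : ℝ))
  calc P.real {G | ¬ WDC (matrixOfRows G) ε} ≤ P.real (U₁ ∪ U₂ ∪ U₃) := measureReal_mono hsub
    _ ≤ P.real U₁ + P.real U₂ + P.real U₃ :=
        (measureReal_union_le _ _).trans (by gcongr; exact measureReal_union_le _ _)
    _ ≤ n * Real.exp (-k) + 2 * Real.exp (-k) + 2 * Real.exp (-k) := by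
        gcongr
        exact pi_stdGaussian_real_exists_norm_gt_le n k
    _ ≤ 5 * n * Real.exp (-k) := by nlinarith

/-! ### The range of a network lies in a union of few subspaces -/

/-- The set of coordinates at which a vector is positive. -/
noncomputable def posSet {n : ℕ} (u : EuclideanSpace ℝ (Fin n)) : Finset (Fin n) := {i | 0 < u i}

theorem mem_posSet {n : ℕ} {u : EuclideanSpace ℝ (Fin n)} {i : Fin n} :
    i ∈ posSet u ↔ 0 < u i := by
  simp [posSet]

open Classical in
/-- The positivity patterns that occur in the range of a linear map. -/
noncomputable def patterns {E : Type*} [AddCommGroup E] [Module ℝ E] {n : ℕ}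
    (F : E →ₗ[ℝ] EuclideanSpace ℝ (Fin n)) : Finset (Finset (Fin n)) :=
  {S | ∃ x, posSet (F x) = S}

theorem mem_patterns {E : Type*} [AddCommGroup E] [Module ℝ E] {n : ℕ}
    {F : E →ₗ[ℝ] EuclideanSpace ℝ (Fin n)} {S : Finset (Fin n)} :
    S ∈ patterns F ↔ ∃ x, posSet (F x) = S := by
  simp [patterns]

/-- The coordinate functionals indexed by `S` are independent. Given a relation `∑ cᵢ φᵢ = 0` with
some `cⱼ > 0`, shattering yields `x` whose positive coordinates in `S` are exactly those with `cᵢ >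
0`; every term of the relation at `x` is then nonnegative and the `j`-th is positive. Negating the
relation excludes `cⱼ < 0`. -/
theorem card_le_finrank_of_shatters {E : Type*} [AddCommGroup E] [Module ℝ E]
    [FiniteDimensional ℝ E] {n : ℕ} {F : E →ₗ[ℝ] EuclideanSpace ℝ (Fin n)} {S : Finset (Fin n)}
    (hS : (patterns F).Shatters S) : S.card ≤ Module.finrank ℝ E := by
  classical
  let φ : Fin n → Module.Dual ℝ E := fun i => (EuclideanSpace.proj i).toLinearMap ∘ₗ F
  have hφ : ∀ i x, φ i x = F x i := fun i x => rfl
  have key : ∀ c : Fin n → ℝ, ∑ i ∈ S, c i • φ i = 0 → ∀ j ∈ S, ¬ 0 < c j := by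
    intro c hc j hj hcj
    obtain ⟨u, hu, hSu⟩ := hS (Finset.filter_subset (fun i => 0 < c i) S)
    obtain ⟨x, rfl⟩ := mem_patterns.mp hu
    have hsum : ∑ i ∈ S, c i * F x i = 0 := by
      have := LinearMap.congr_fun hc x
      simpa [LinearMap.sum_apply, hφ] using this
    have hmem : ∀ i ∈ S, (0 < F x i ↔ 0 < c i) := by
      intro i hi
      have := Finset.ext_iff.mp hSu i
      simpa [hi, mem_posSet] using this
    have hpos : 0 < ∑ i ∈ S, c i * F x i := by
      refine Finset.sum_pos' (fun i hi => ?_) ⟨j, hj, mul_pos hcj ((hmem j hj).mpr hcj)⟩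
      by_cases h : 0 < c i
      · exact (mul_pos h ((hmem i hi).mpr h)).le
      · exact mul_nonneg_of_nonpos_of_nonpos (not_lt.mp h)
          (not_lt.mp fun h' => h ((hmem i hi).mp h'))
    linarith
  have hli : LinearIndepOn ℝ φ (S : Set (Fin n)) := by
    rw [linearIndepOn_finset_iff]
    intro c hc j hj
    refine le_antisymm (not_lt.mp (key c hc j hj)) (not_lt.mp fun h => ?_)
    refine key (fun i => -c i) ?_ j hj (neg_pos.mpr h)
    rw [Finset.sum_congr rfl fun i _ => neg_smul (c i) (φ i), Finset.sum_neg_distrib, hc, neg_zero]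
  have h : Fintype.card S ≤ Module.finrank ℝ (Module.Dual ℝ E) :=
    LinearIndependent.fintype_card_le_finrank hli
  rwa [Fintype.card_coe, Subspace.dual_finrank_eq] at h

theorem sum_choose_le_pow (n k d : ℕ) (hd : d ≤ k) :
    ∑ j ∈ Finset.Iic d, n.choose j ≤ (n + 1) ^ k := by
  have hsub : Finset.Iic d ⊆ Finset.range (k + 1) := by
    intro j hj
    simp only [Finset.mem_Iic, Finset.mem_range] at *
    omega
  refine (Finset.sum_le_sum_of_subset hsub).trans ?_
  rw [add_pow]
  refine Finset.sum_le_sum fun j hj => ?_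
  have h1 : 1 ≤ k.choose j := Nat.choose_pos (by simp only [Finset.mem_range] at hj; omega)
  calc n.choose j ≤ n ^ j := Nat.choose_le_pow n j
    _ ≤ n ^ j * 1 ^ (k - j) * k.choose j := by
      rw [one_pow, mul_one]
      exact Nat.le_mul_of_pos_right _ h1

/-- Sauer–Shelah bound for positivity patterns. -/
theorem card_patterns_le {E : Type*} [AddCommGroup E] [Module ℝ E] [FiniteDimensional ℝ E] {n : ℕ}
    (F : E →ₗ[ℝ] EuclideanSpace ℝ (Fin n)) :
    (patterns F).card ≤ (n + 1) ^ Module.finrank ℝ E := by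
  have h1 := Finset.card_le_card_shatterer (patterns F)
  have h2 := Finset.card_shatterer_le_sum_vcDim (𝒜 := patterns F)
  have h3 : (patterns F).vcDim ≤ Module.finrank ℝ E :=
    Finset.sup_le fun S hS => card_le_finrank_of_shatters (Finset.mem_shatterer.mp hS)
  rw [Fintype.card_fin] at h2
  exact h1.trans (h2.trans (sum_choose_le_pow _ _ _ h3))

/-- The coordinate projection that keeps the coordinates in `S`. -/
noncomputable def mask {n : ℕ} (S : Finset (Fin n)) :
    EuclideanSpace ℝ (Fin n) →ₗ[ℝ] EuclideanSpace ℝ (Fin n) where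
  toFun u := WithLp.toLp 2 fun i => if i ∈ S then u i else 0
  map_add' u v := by
    ext i
    simp only [PiLp.add_apply]
    split_ifs <;> simp
  map_smul' c u := by
    ext i
    simp

theorem relu_eq_mask {n : ℕ} (u : EuclideanSpace ℝ (Fin n)) : relu u = mask (posSet u) u := by
  ext i
  simp only [relu, mask, LinearMap.coe_mk, AddHom.coe_mk, mem_posSet]
  split_ifs with h
  · exact max_eq_left h.le
  · exact max_eq_right (not_lt.mp h)

/-- A linear piece of the first layers is refined by the sign patterns of its next pre-activation.
All maps start from `ℝ^(n 0)`, so the exponent in the pattern count stays `n 0` at every depth,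
whatever the layer widths. -/
theorem exists_layerOutput_pieces {d : ℕ} {n : Fin (d + 1) → ℕ}
    (W : (i : Fin d) → Matrix (Fin (n i.succ)) (Fin (n i.castSucc)) ℝ) (i : Fin (d + 1)) :
    ∃ L : Finset (EuclideanSpace ℝ (Fin (n 0)) →ₗ[ℝ] EuclideanSpace ℝ (Fin (n i))),
      (∀ x, ∃ l ∈ L, layerOutput W x i = l x) ∧
      L.card ≤ ∏ j : Fin d with j.castSucc < i, (n j.succ + 1) ^ n 0 := by
  classical
  induction i using Fin.induction with
  | zero =>
    exact ⟨{LinearMap.id}, fun x => ⟨LinearMap.id, by simp, rfl⟩, by simp⟩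
  | succ i ih =>
    obtain ⟨L, hL, hcard⟩ := ih
    let V : (EuclideanSpace ℝ (Fin (n 0)) →ₗ[ℝ] EuclideanSpace ℝ (Fin (n i.castSucc))) →
        (EuclideanSpace ℝ (Fin (n 0)) →ₗ[ℝ] EuclideanSpace ℝ (Fin (n i.succ))) :=
      fun l => Matrix.toEuclideanLin (W i) ∘ₗ l
    refine ⟨L.biUnion fun l => (patterns (V l)).image fun S => mask S ∘ₗ V l, ?_, ?_⟩
    · intro x
      obtain ⟨l, hl, hxl⟩ := hL x
      refine ⟨mask (posSet (V l x)) ∘ₗ V l, ?_, ?_⟩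
      · simp only [Finset.mem_biUnion, Finset.mem_image]
        exact ⟨l, hl, _, mem_patterns.mpr ⟨x, rfl⟩, rfl⟩
      · have h : layerOutput W x i.succ = relu (act (W i) (layerOutput W x i.castSucc)) := rfl
        rw [h, hxl, relu_eq_mask]
        rfl
    · have hset : ({j : Fin d | j.castSucc < i.succ} : Finset (Fin d)) =
          insert i ({j : Fin d | j.castSucc < i.castSucc} : Finset (Fin d)) := by
        ext j
        simp only [Finset.mem_filter, Finset.mem_univ, true_and, Finset.mem_insert,
          Fin.castSucc_lt_succ_iff, Fin.castSucc_lt_castSucc_iff]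
        exact le_iff_eq_or_lt
      rw [hset, Finset.prod_insert (by simp), mul_comm]
      refine Finset.card_biUnion_le_card_mul _ _ _ (fun l _ => ?_) |>.trans
        (Nat.mul_le_mul_right _ hcard)
      refine Finset.card_image_le.trans ((card_patterns_le _).trans ?_)
      rw [finrank_euclideanSpace_fin]

theorem exists_network_pieces {d : ℕ} {n : Fin (d + 1) → ℕ}
    (W : (i : Fin d) → Matrix (Fin (n i.succ)) (Fin (n i.castSucc)) ℝ) :
    ∃ L : Finset (EuclideanSpace ℝ (Fin (n 0)) →ₗ[ℝ] EuclideanSpace ℝ (Fin (n (Fin.last d)))),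
      (∀ x, ∃ l ∈ L, network W x = l x) ∧ L.card ≤ ∏ j : Fin d, (n j.succ + 1) ^ n 0 := by
  obtain ⟨L, hL, hcard⟩ := exists_layerOutput_pieces W (Fin.last d)
  refine ⟨L, hL, hcard.trans_eq ?_⟩
  simp [Fin.castSucc_lt_last]

/-! ### The Range Restricted Isometry Condition for Gaussian matrices -/

theorem inner_act_matrixOfRows {m n : ℕ} (H : Fin m → EuclideanSpace ℝ (Fin n))
    (u v : EuclideanSpace ℝ (Fin n)) :
    inner ℝ (act (matrixOfRows H) u) (act (matrixOfRows H) v) =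
      (m : ℝ)⁻¹ * ∑ i, inner ℝ u (H i) * inner ℝ v (H i) := by
  have h : ∀ (w : EuclideanSpace ℝ (Fin n)) (i : Fin m),
      (act (matrixOfRows H) w) i = (√m)⁻¹ * inner ℝ w (H i) := fun w i =>
    matrixOfRows_dotProduct H i w
  have h2 : (√(m : ℝ))⁻¹ * (√(m : ℝ))⁻¹ = (m : ℝ)⁻¹ := by
    rw [← mul_inv, Real.mul_self_sqrt (by positivity)]
  rw [PiLp.inner_apply, Finset.mul_sum, ← h2]
  refine Finset.sum_congr rfl fun i _ => ?_
  rw [h, h, RCLike.inner_apply, conj_trivial]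
  ring

/-- The matrix acts on the subspace `U` as an isometry up to a relative error `ε`. -/
def IsNearIsometryOn {m n : ℕ} (A : Matrix (Fin m) (Fin n) ℝ)
    (U : Submodule ℝ (EuclideanSpace ℝ (Fin n))) (ε : ℝ) : Prop :=
  ∀ u ∈ U, ∀ v ∈ U, |inner ℝ (act A u) (act A v) - inner ℝ u v| ≤ ε * ‖u‖ * ‖v‖

/-- The form is that of the self-adjoint operator `B* B - id` on `U`, so control of its diagonal on
a net bounds all pairs `u, v`. -/
theorem isNearIsometryOn_of_sphereNet {m n : ℕ} {A : Matrix (Fin m) (Fin n) ℝ}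
    {U : Submodule ℝ (EuclideanSpace ℝ (Fin n))} {t : ℝ} (ht : 0 ≤ t) {N : Finset U}
    (hN : IsSphereNet (1 / 4) N)
    (h : ∀ z ∈ N, |inner ℝ (act A (z : EuclideanSpace ℝ (Fin n))) (act A z) - 1| ≤ t) :
    IsNearIsometryOn A U (2 * t) := by
  set B : U →L[ℝ] EuclideanSpace ℝ (Fin m) :=
    (LinearMap.toContinuousLinearMap (Matrix.toEuclideanLin A)) ∘L U.subtypeL with hB
  set T : U →L[ℝ] U := ContinuousLinearMap.adjoint B ∘L B - ContinuousLinearMap.id ℝ U with hT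
  have hBact : ∀ u : U, B u = act A u := fun u => rfl
  have hinner : ∀ u v : U, inner ℝ u (T v) = inner ℝ (act A (u : EuclideanSpace ℝ (Fin n)))
      (act A v) - inner ℝ (u : EuclideanSpace ℝ (Fin n)) v := by
    intro u v
    rw [hT, sub_apply, inner_sub_right, ContinuousLinearMap.comp_apply,
      ContinuousLinearMap.adjoint_inner_right, hBact, hBact]
    rfl
  have hsymm : ∀ u v : U, inner ℝ (T u) v = inner ℝ u (T v) := by
    intro u v
    rw [real_inner_comm, hinner, hinner, real_inner_comm (act A _),
      real_inner_comm (u : EuclideanSpace ℝ (Fin n))]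
  have hnorm : ‖T‖ ≤ 2 * t := by
    refine opNorm_le_of_sphereNet hsymm le_rfl hN ht fun z hz => ?_
    have hz1 : ‖(z : EuclideanSpace ℝ (Fin n))‖ = 1 := hN.norm_eq_one z hz
    rw [hinner, real_inner_self_eq_norm_sq (z : EuclideanSpace ℝ (Fin n)), hz1, one_pow]
    exact h z hz
  intro u hu v hv
  have h1 := hinner ⟨u, hu⟩ ⟨v, hv⟩
  rw [← h1]
  calc |inner ℝ (⟨u, hu⟩ : U) (T ⟨v, hv⟩)| ≤ ‖u‖ * ‖T ⟨v, hv⟩‖ := abs_real_inner_le_norm _ _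
    _ ≤ ‖u‖ * (2 * t * ‖v‖) := by
        gcongr
        exact (T.le_opNorm _).trans (by gcongr; rfl)
    _ = 2 * t * ‖u‖ * ‖v‖ := by ring

theorem pi_stdGaussian_real_not_isNearIsometryOn_le {m n : ℕ} (hm : 0 < m)
    {U : Submodule ℝ (EuclideanSpace ℝ (Fin n))} {r : ℕ} (hr : 0 < r)
    (hU : Module.finrank ℝ U ≤ r) {ε : ℝ} (hε0 : 0 < ε) (hε1 : ε < 1) :
    (Measure.pi fun _ : Fin m => stdGaussian (EuclideanSpace ℝ (Fin n))).real
      {H | ¬ IsNearIsometryOn (matrixOfRows H) U ε} ≤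
        (20 * r) ^ r * (2 * Real.exp (-(m * (ε / 2) ^ 2 / 800))) := by
  obtain ⟨N, hN, hcard⟩ := exists_sphereNet (F := U) hr hU (δ := 1 / 4) (by norm_num) (by norm_num)
  have hsub : {H | ¬ IsNearIsometryOn (matrixOfRows H) U ε} ⊆ ⋃ z ∈ N,
      {H : Fin m → EuclideanSpace ℝ (Fin n) | ε / 2 < |(m : ℝ)⁻¹ *
        ∑ i, (inner ℝ (z : EuclideanSpace ℝ (Fin n)) (H i)) ^ 2 -
          ∫ g, (inner ℝ (z : EuclideanSpace ℝ (Fin n)) g) ^ 2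
            ∂(stdGaussian (EuclideanSpace ℝ (Fin n)))|} := by
    intro H hH
    by_contra hbad
    simp only [Set.mem_iUnion, Set.mem_ofPred_eq, not_exists, not_lt] at hbad
    apply hH
    have h := isNearIsometryOn_of_sphereNet (A := matrixOfRows H) (t := ε / 2) (by positivity) hN
      fun z hz => by
        have h1 := hbad z hz
        have hz1 : ‖(z : EuclideanSpace ℝ (Fin n))‖ = 1 := hN.norm_eq_one z hz
        rw [integral_inner_sq hz1] at h1
        rw [inner_act_matrixOfRows]
        simp_rw [← sq]
        exact h1
    rwa [mul_div_cancel₀ _ (two_ne_zero)] at h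
  refine (measureReal_mono hsub (measure_ne_top _ _)).trans
    ((measureReal_biUnion_finset_le _ _).trans ?_)
  have hconc : ∀ z ∈ N, _ := fun z hz => pi_stdGaussian_real_le_abs_mean_sub hm
    (z := (z : EuclideanSpace ℝ (Fin n))) (hN.norm_eq_one z hz)
    (f := fun g => (inner ℝ (z : EuclideanSpace ℝ (Fin n)) g) ^ 2) (by fun_prop)
    (fun g => (abs_of_nonneg (sq_nonneg _)).le) (t := ε / 2) (by positivity) (by linarith)
  refine (Finset.sum_le_sum hconc).trans ?_
  rw [Finset.sum_const, nsmul_eq_mul]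
  gcongr
  refine hcard.trans_eq ?_
  congr 1
  ring

/-- Both differences lie in one subspace, the sum of the four ranges; this is why quadruples of
pieces and dimension `4k` appear below. -/
theorem RRIC_of_pieces {m n k : ℕ} {A : Matrix (Fin m) (Fin n) ℝ}
    {G : EuclideanSpace ℝ (Fin k) → EuclideanSpace ℝ (Fin n)} {ε : ℝ}
    {L : Finset (EuclideanSpace ℝ (Fin k) →ₗ[ℝ] EuclideanSpace ℝ (Fin n))}
    (hL : ∀ x, ∃ l ∈ L, G x = l x)
    (h : ∀ l₁ ∈ L, ∀ l₂ ∈ L, ∀ l₃ ∈ L, ∀ l₄ ∈ L,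
      IsNearIsometryOn A ((l₁.range ⊔ l₂.range) ⊔ (l₃.range ⊔ l₄.range)) ε) : RRIC A G ε := by
  intro x₁ x₂ x₃ x₄
  obtain ⟨l₁, h1, e1⟩ := hL x₁
  obtain ⟨l₂, h2, e2⟩ := hL x₂
  obtain ⟨l₃, h3, e3⟩ := hL x₃
  obtain ⟨l₄, h4, e4⟩ := hL x₄
  rw [e1, e2, e3, e4]
  refine h l₁ h1 l₂ h2 l₃ h3 l₄ h4 _ ?_ _ ?_
  · exact Submodule.mem_sup_left (Submodule.sub_mem _
      (Submodule.mem_sup_left (l₁.mem_range_self x₁))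
      (Submodule.mem_sup_right (l₂.mem_range_self x₂)))
  · exact Submodule.mem_sup_right (Submodule.sub_mem _
      (Submodule.mem_sup_left (l₃.mem_range_self x₃))
      (Submodule.mem_sup_right (l₄.mem_range_self x₄)))

theorem pi_stdGaussian_real_not_RRIC_le_of_pieces {m n k : ℕ} (hm : 0 < m) (hk : 0 < k)
    {G : EuclideanSpace ℝ (Fin k) → EuclideanSpace ℝ (Fin n)}
    {L : Finset (EuclideanSpace ℝ (Fin k) →ₗ[ℝ] EuclideanSpace ℝ (Fin n))}
    (hL : ∀ x, ∃ l ∈ L, G x = l x) {ε : ℝ} (hε0 : 0 < ε) (hε1 : ε < 1) :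
    (Measure.pi fun _ : Fin m => stdGaussian (EuclideanSpace ℝ (Fin n))).real
      {H | ¬ RRIC (matrixOfRows H) G ε} ≤ (L.card : ℝ) ^ 4 *
        ((80 * k) ^ (4 * k) * (2 * Real.exp (-(m * ε ^ 2 / 3200)))) := by
  have hsub : {H : Fin m → EuclideanSpace ℝ (Fin n) | ¬ RRIC (matrixOfRows H) G ε} ⊆
      ⋃ p ∈ L ×ˢ L ×ˢ L ×ˢ L, {H | ¬ IsNearIsometryOn (matrixOfRows H)
        ((p.1.range ⊔ p.2.1.range) ⊔ (p.2.2.1.range ⊔ p.2.2.2.range)) ε} := by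
    intro H hH
    by_contra hbad
    simp only [Set.mem_iUnion, Set.mem_ofPred_eq, not_exists, not_not, Finset.mem_product,
      Prod.forall] at hbad
    exact hH (RRIC_of_pieces hL fun l₁ h1 l₂ h2 l₃ h3 l₄ h4 =>
      hbad l₁ l₂ l₃ l₄ ⟨h1, h2, h3, h4⟩)
  have hrank : ∀ l₁ l₂ l₃ l₄ : EuclideanSpace ℝ (Fin k) →ₗ[ℝ] EuclideanSpace ℝ (Fin n),
      Module.finrank ℝ ((l₁.range ⊔ l₂.range) ⊔ (l₃.range ⊔ l₄.range) :
        Submodule ℝ (EuclideanSpace ℝ (Fin n))) ≤ 4 * k := by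
    intro l₁ l₂ l₃ l₄
    have hl : ∀ l : EuclideanSpace ℝ (Fin k) →ₗ[ℝ] EuclideanSpace ℝ (Fin n),
        Module.finrank ℝ l.range ≤ k := fun l =>
      (LinearMap.finrank_range_le l).trans_eq finrank_euclideanSpace_fin
    have h1 := Submodule.finrank_add_le_finrank_add_finrank (l₁.range ⊔ l₂.range)
      (l₃.range ⊔ l₄.range)
    have h2 := Submodule.finrank_add_le_finrank_add_finrank l₁.range l₂.range
    have h3 := Submodule.finrank_add_le_finrank_add_finrank l₃.range l₄.range
    linarith [hl l₁, hl l₂, hl l₃, hl l₄]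
  refine (measureReal_mono hsub (measure_ne_top _ _)).trans
    ((measureReal_biUnion_finset_le _ _).trans ?_)
  refine (Finset.sum_le_sum fun p _ => pi_stdGaussian_real_not_isNearIsometryOn_le hm
    (by positivity) (hrank p.1 p.2.1 p.2.2.1 p.2.2.2) hε0 hε1).trans ?_
  rw [Finset.sum_const, nsmul_eq_mul, Finset.card_product, Finset.card_product,
    Finset.card_product]
  apply le_of_eq
  push_cast
  ring_nf

/-- All counts are measured in powers of `p = ∏ n_j`. Since `n_j + 1 ≤ n_j ^ 2`, quadruples of
pieces number at most `p ^ (8 n 0)`; since `80 n 0 ≤ p ^ 8`, the net costs `p ^ (32 n 0)`. The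
constant `256000 = 40 * 6400` makes the total `p ^ (40 n 0)` consume at most half of the exponent `m
ε² / 3200`. -/
theorem pi_stdGaussian_real_not_RRIC_network_le {d : ℕ} {n : Fin (d + 1) → ℕ} {m : ℕ}
    (hn0 : 0 < n 0) (hn : ∀ j : Fin d, 2 ≤ n j.succ) (hprod : n 0 ≤ ∏ j : Fin d, n j.succ)
    (hprod2 : 2 ≤ ∏ j : Fin d, n j.succ)
    {ε : ℝ} (hε0 : 0 < ε) (hε1 : ε < 1)
    (hm : 256000 * ε⁻¹ ^ 2 * n 0 * Real.log (∏ j : Fin d, (n j.succ : ℝ)) < m)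
    (W : (i : Fin d) → Matrix (Fin (n i.succ)) (Fin (n i.castSucc)) ℝ) :
    (Measure.pi fun _ : Fin m => stdGaussian (EuclideanSpace ℝ (Fin (n (Fin.last d))))).real
      {H | ¬ RRIC (matrixOfRows H) (network W) ε} ≤ 2 * Real.exp (-(ε ^ 2 / 6400) * m) := by
  obtain ⟨L, hL, hcard⟩ := exists_network_pieces W
  obtain ⟨p, hp⟩ : ∃ p, p = ∏ j : Fin d, n j.succ := ⟨_, rfl⟩
  have hp' : ∏ j : Fin d, (n j.succ : ℝ) = p := by
    rw [hp]
    push_cast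
    rfl
  rw [hp'] at hm
  rw [← hp] at hprod hprod2
  have hp2 : (2 : ℝ) ≤ p := by exact_mod_cast hprod2
  have hlog : 0 < Real.log p := Real.log_pos (by linarith)
  have hn0' : (0 : ℝ) < n 0 := by exact_mod_cast hn0
  have hm0 : 0 < m := by
    have : (0 : ℝ) < m := lt_of_le_of_lt (by positivity) hm
    exact_mod_cast this
  have hLp : L.card ≤ p ^ (2 * n 0) := by
    refine hcard.trans ?_
    rw [Finset.prod_pow, pow_mul, hp]
    refine Nat.pow_le_pow_left ?_ _
    rw [← Finset.prod_pow]
    exact Finset.prod_le_prod' fun j _ => by nlinarith [hn j]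
  have hkp : (80 * n 0) ^ (4 * n 0) ≤ p ^ (32 * n 0) := by
    have h80 : 80 ≤ p ^ 7 := by
      calc 80 ≤ 2 ^ 7 := by norm_num
        _ ≤ p ^ 7 := by gcongr
    calc (80 * n 0) ^ (4 * n 0) ≤ (p ^ 7 * p) ^ (4 * n 0) := by gcongr
      _ = p ^ (32 * n 0) := by
        rw [← pow_succ, ← pow_mul]
        congr 1
        ring
  have hLp' : (L.card : ℝ) ≤ (p : ℝ) ^ (2 * n 0) := by exact_mod_cast hLp
  have hkp' : (80 * (n 0 : ℝ)) ^ (4 * n 0) ≤ (p : ℝ) ^ (32 * n 0) := by exact_mod_cast hkp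
  refine (pi_stdGaussian_real_not_RRIC_le_of_pieces hm0 hn0 hL hε0 hε1).trans ?_
  have hpexp : (p : ℝ) ^ (40 * n 0) = Real.exp (40 * n 0 * Real.log p) := by
    rw [← Real.exp_log (show (0 : ℝ) < p by linarith), ← Real.exp_nat_mul, Real.log_exp]
    push_cast
    ring_nf
  have hmε : 40 * n 0 * Real.log p ≤ ε ^ 2 / 6400 * m := by
    have h1 : 256000 * ε⁻¹ ^ 2 * n 0 * Real.log p * ε ^ 2 ≤ m * ε ^ 2 := by gcongr
    have h2 : 256000 * ε⁻¹ ^ 2 * n 0 * Real.log p * ε ^ 2 = 256000 * (n 0 * Real.log p) := by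
      field_simp
    rw [h2] at h1
    linarith
  calc (L.card : ℝ) ^ 4 * ((80 * n 0) ^ (4 * n 0) * (2 * Real.exp (-(m * ε ^ 2 / 3200))))
      ≤ ((p : ℝ) ^ (2 * n 0)) ^ 4 *
          ((p : ℝ) ^ (32 * n 0) * (2 * Real.exp (-(m * ε ^ 2 / 3200)))) := by gcongr
    _ = 2 * ((p : ℝ) ^ (40 * n 0) * Real.exp (-(m * ε ^ 2 / 3200))) := by
        rw [← pow_mul, show 40 * n 0 = 2 * n 0 * 4 + 32 * n 0 by ring, pow_add]
        ring
    _ = 2 * Real.exp (40 * n 0 * Real.log p + -(m * ε ^ 2 / 3200)) := by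
        rw [hpexp, ← Real.exp_add]
    _ ≤ 2 * Real.exp (-(ε ^ 2 / 6400) * m) := by
        gcongr
        linarith

/-! ### From matrices with Gaussian entries to Gaussian rows -/

/-- The rows of a matrix, multiplied by the square root of their number. -/
noncomputable def scaledRows {m n : ℕ} (A : Matrix (Fin m) (Fin n) ℝ) (i : Fin m) :
    EuclideanSpace ℝ (Fin n) :=
  WithLp.toLp 2 fun j => √m * A i j

theorem matrixOfRows_scaledRows {m n : ℕ} (A : Matrix (Fin m) (Fin n) ℝ) :
    matrixOfRows (scaledRows A) = A := by
  ext i j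
  have hm : 0 < m := i.pos
  have : √(m : ℝ) ≠ 0 := by positivity
  simp [matrixOfRows, scaledRows, this]

section Law

variable {Ω : Type*} [MeasurableSpace Ω] {μ : Measure Ω} {m n : ℕ}
  {X : Ω → Matrix (Fin m) (Fin n) ℝ}

theorem IIDGaussianEntries.hasLaw_scaledRows (hm : 0 < m)
    (hX : IIDGaussianEntries X (m : ℝ≥0)⁻¹ μ) :
    HasLaw (fun ω => scaledRows (X ω))
      (Measure.pi fun _ : Fin m => stdGaussian (EuclideanSpace ℝ (Fin n))) μ := by
  obtain ⟨hind, hlaw⟩ := hX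
  have hY : ∀ p : Fin m × Fin n, HasLaw (fun ω => √m * X ω p.1 p.2) (gaussianReal 0 1) μ := by
    intro p
    have h := gaussianReal_const_mul (hlaw p.1 p.2) (√m)
    convert h using 1
    have hm' : (m : ℝ) ≠ 0 := by positivity
    congr 1
    · simp
    · ext
      simp [Real.sq_sqrt, hm']
  have hYind : iIndepFun (fun (p : Fin m × Fin n) ω => √m * X ω p.1 p.2) μ :=
    hind.comp (fun _ x => √m * x) fun _ => by fun_prop
  have h1 := hYind.hasLaw_pi hY
  have hcurry : MeasurePreserving (MeasurableEquiv.curry (Fin m) (Fin n) ℝ)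
      (Measure.pi fun _ : Fin m × Fin n => gaussianReal 0 1)
      (Measure.pi fun _ : Fin m => Measure.pi fun _ : Fin n => gaussianReal 0 1) := by
    refine ⟨MeasurableEquiv.measurable _, ?_⟩
    have h := Measure.infinitePi_map_curry (ι := Fin m) (κ := Fin n)
      (fun _ _ => gaussianReal 0 1)
    simpa only [Measure.infinitePi_eq_pi] using h
  have hlp : MeasurePreserving (fun (g : Fin m → Fin n → ℝ) i => WithLp.toLp 2 (g i))
      (Measure.pi fun _ : Fin m => Measure.pi fun _ : Fin n => gaussianReal 0 1)
      (Measure.pi fun _ : Fin m => stdGaussian (EuclideanSpace ℝ (Fin n))) :=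
    measurePreserving_pi _ _ fun _ => ⟨by fun_prop, map_pi_eq_stdGaussian⟩
  refine ⟨((hlp.comp hcurry).measurable.comp_aemeasurable h1.aemeasurable), ?_⟩
  have h2 := (hlp.comp hcurry).map_eq
  rw [← h1.map_eq, AEMeasurable.map_map_of_aemeasurable (by fun_prop) h1.aemeasurable] at h2
  exact h2

/-- Only an inequality is claimed because the event need not be measurable: for an arbitrary set,
the outer measure of a preimage is at most that of the set under the image measure. -/
theorem IIDGaussianEntries.measureReal_le (hm : 0 < m) [IsProbabilityMeasure μ]
    (hX : IIDGaussianEntries X (m : ℝ≥0)⁻¹ μ) (P : Matrix (Fin m) (Fin n) ℝ → Prop) :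
    μ.real {ω | P (X ω)} ≤
      (Measure.pi fun _ : Fin m => stdGaussian (EuclideanSpace ℝ (Fin n))).real
        {H | P (matrixOfRows H)} := by
  have hlaw := hX.hasLaw_scaledRows hm
  have h := Measure.le_map_apply hlaw.aemeasurable
    {H : Fin m → EuclideanSpace ℝ (Fin n) | P (matrixOfRows H)}
  rw [hlaw.map_eq] at h
  refine ENNReal.toReal_mono (measure_ne_top _ _) (le_trans (le_of_eq ?_) h)
  congr 1
  ext ω
  simp [matrixOfRows_scaledRows]

theorem IIDGaussianEntries.aemeasurable {v : ℝ≥0} (hX : IIDGaussianEntries X v μ) :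
    AEMeasurable (fun ω (i : Fin m) (j : Fin n) => X ω i j) μ :=
  aemeasurable_pi_iff.mpr fun i => aemeasurable_pi_iff.mpr fun j => (hX.2 i j).aemeasurable

end Law

/-! ### Conditioning on the weights of the network -/

theorem continuous_act {X : Type*} [TopologicalSpace X] {m n : ℕ}
    {A : X → Matrix (Fin m) (Fin n) ℝ} {u : X → EuclideanSpace ℝ (Fin n)} (hA : Continuous A)
    (hu : Continuous u) : Continuous fun x => act (A x) (u x) := by
  unfold act
  exact (PiLp.continuous_toLp 2 _).comp (hA.matrix_mulVec ((PiLp.continuous_ofLp 2 _).comp hu))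

theorem continuous_relu {n : ℕ} : Continuous (relu : EuclideanSpace ℝ (Fin n) → _) := by
  unfold relu
  fun_prop

theorem continuous_layerOutput {d : ℕ} {n : Fin (d + 1) → ℕ} (x : EuclideanSpace ℝ (Fin (n 0)))
    (i : Fin (d + 1)) :
    Continuous fun W : (i : Fin d) → Matrix (Fin (n i.succ)) (Fin (n i.castSucc)) ℝ =>
      layerOutput W x i := by
  induction i using Fin.induction with
  | zero => exact continuous_const
  | succ i ih => exact continuous_relu.comp (continuous_act (continuous_apply i) ih)

/-- Failure is a strict inequality for some quadruple of inputs, continuous in the weights and in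
`A`; so the bad set is a union of open sets. This provides the measurability that Fubini requires.
-/
theorem isOpen_not_RRIC {d : ℕ} {n : Fin (d + 1) → ℕ} {m : ℕ} (ε : ℝ) :
    IsOpen {p : ((i : Fin d) → Matrix (Fin (n i.succ)) (Fin (n i.castSucc)) ℝ) ×
      Matrix (Fin m) (Fin (n (Fin.last d))) ℝ | ¬ RRIC p.2 (network p.1) ε} := by
  simp only [RRIC, not_forall, not_le, Set.ofPred_exists]
  refine isOpen_iUnion fun x₁ => isOpen_iUnion fun x₂ => isOpen_iUnion fun x₃ =>
    isOpen_iUnion fun x₄ => isOpen_lt ?_ ?_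
  all_goals
    have hG : ∀ x, Continuous fun p : ((i : Fin d) →
        Matrix (Fin (n i.succ)) (Fin (n i.castSucc)) ℝ) ×
        Matrix (Fin m) (Fin (n (Fin.last d))) ℝ => network p.1 x := fun x =>
      (continuous_layerOutput x _).comp continuous_fst
    have hD : ∀ x y, Continuous fun p : ((i : Fin d) →
        Matrix (Fin (n i.succ)) (Fin (n i.castSucc)) ℝ) ×
        Matrix (Fin m) (Fin (n (Fin.last d))) ℝ => network p.1 x - network p.1 y := fun x y =>
      (hG x).sub (hG y)
  · exact (continuous_const.mul (hD _ _).norm).mul (hD _ _).norm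
  · exact (((continuous_act continuous_snd (hD _ _)).inner (continuous_act continuous_snd
      (hD _ _))).sub ((hD _ _).inner (hD _ _))).abs

/-- Independence makes the joint law a product, and every section of `B` has measure at most `b`. -/
theorem measureReal_le_of_indepFun {Ω 𝒳 𝒴 : Type*} [MeasurableSpace Ω] [MeasurableSpace 𝒳]
    [MeasurableSpace 𝒴] {μ : Measure Ω} [IsProbabilityMeasure μ] {X : Ω → 𝒳} {Y : Ω → 𝒴}
    (hX : AEMeasurable X μ) (hY : AEMeasurable Y μ) (hXY : IndepFun X Y μ) {B : Set (𝒳 × 𝒴)}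
    (hB : MeasurableSet B) {b : ℝ} (hb : 0 ≤ b) (h : ∀ x, μ.real {ω | (x, Y ω) ∈ B} ≤ b) :
    μ.real {ω | (X ω, Y ω) ∈ B} ≤ b := by
  have : IsProbabilityMeasure (μ.map X) := Measure.isProbabilityMeasure_map hX
  have : IsProbabilityMeasure (μ.map Y) := Measure.isProbabilityMeasure_map hY
  have h1 : μ {ω | (X ω, Y ω) ∈ B} = ((μ.map X).prod (μ.map Y)) B := by
    rw [← (indepFun_iff_map_prod_eq_prod_map_map hX hY).mp hXY,
      Measure.map_apply_of_aemeasurable (hX.prodMk hY) hB]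
    rfl
  rw [measureReal_def]
  refine ENNReal.toReal_le_of_le_ofReal hb ?_
  rw [h1, Measure.prod_apply hB]
  calc ∫⁻ x, (μ.map Y) (Prod.mk x ⁻¹' B) ∂(μ.map X) ≤ ∫⁻ _, ENNReal.ofReal b ∂(μ.map X) := by
        refine lintegral_mono fun x => ?_
        rw [Measure.map_apply_of_aemeasurable hY (measurable_prodMk_left hB)]
        exact (ENNReal.le_ofReal_iff_toReal_le (measure_ne_top _ _) hb).mpr (h x)
    _ = ENNReal.ofReal b := by simp

theorem measureReal_not_RRIC_network_le {Ω : Type*} [MeasurableSpace Ω] {μ : Measure Ω}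
    [IsProbabilityMeasure μ] {d : ℕ} {n : Fin (d + 1) → ℕ} {m : ℕ}
    {W : (i : Fin d) → Ω → Matrix (Fin (n i.succ)) (Fin (n i.castSucc)) ℝ}
    {A : Ω → Matrix (Fin m) (Fin (n (Fin.last d))) ℝ} {v : Fin d → ℝ≥0}
    (hW : ∀ i, IIDGaussianEntries (W i) (v i) μ) (hm : 0 < m)
    (hA : IIDGaussianEntries A (m : ℝ≥0)⁻¹ μ)
    (hWA : IndepFun (fun ω (i : Fin d) (j : Fin (n i.succ)) (l : Fin (n i.castSucc)) => W i ω j l)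
      (fun ω (j : Fin m) (l : Fin (n (Fin.last d))) => A ω j l) μ) {ε b : ℝ} (hb : 0 ≤ b)
    (h : ∀ V : (i : Fin d) → Matrix (Fin (n i.succ)) (Fin (n i.castSucc)) ℝ,
      (Measure.pi fun _ : Fin m => stdGaussian (EuclideanSpace ℝ (Fin (n (Fin.last d))))).real
        {H | ¬ RRIC (matrixOfRows H) (network V) ε} ≤ b) :
    μ.real {ω | ¬ RRIC (A ω) (network fun i => W i ω) ε} ≤ b := by
  let B : Set (((i : Fin d) → Fin (n i.succ) → Fin (n i.castSucc) → ℝ) ×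
      (Fin m → Fin (n (Fin.last d)) → ℝ)) :=
    {p | ¬ RRIC (Matrix.of p.2) (network fun i => Matrix.of (p.1 i)) ε}
  have hB : IsOpen B := isOpen_not_RRIC ε
  exact measureReal_le_of_indepFun (aemeasurable_pi_iff.mpr fun i => (hW i).aemeasurable)
    hA.aemeasurable hWA hB.measurableSet hb fun V =>
      (hA.measureReal_le hm fun M => ¬ RRIC M (network fun i => Matrix.of (V i)) ε).trans (h _)

/-! ### Assembly -/

theorem polyInInv_const_mul_pow {C : ℝ} (hC : 0 < C) {p : ℕ} (hp : 0 < p) :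
    PolyInInv fun ε => C * ε⁻¹ ^ p :=
  ⟨C, p, hC, hp, fun _ _ _ => le_rfl⟩

/-- The complement of a measurable hull of the bad set is used, so measurability of `P` is not
needed. -/
theorem exists_measurableSet_of_measureReal_le {Ω : Type*} [MeasurableSpace Ω] {μ : Measure Ω}
    [IsProbabilityMeasure μ] {P : Ω → Prop} {b : ℝ} (h : μ.real {ω | ¬ P ω} ≤ b) :
    ∃ E : Set Ω, MeasurableSet E ∧ 1 - b ≤ μ.real E ∧ ∀ ω ∈ E, P ω := by
  refine ⟨(toMeasurable μ {ω | ¬ P ω})ᶜ, (measurableSet_toMeasurable _ _).compl, ?_, ?_⟩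
  · rw [probReal_compl_eq_one_sub (measurableSet_toMeasurable _ _), measureReal_def,
      measure_toMeasurable, ← measureReal_def]
    linarith
  · intro ω hω
    by_contra hP
    exact hω (subset_toMeasurable _ _ hP)

/-- It makes the widths nondecreasing once they are at least two, so every `n_j ≥ 2` and `n 0 ≤ ∏
n_j`, as the RRIC count requires. -/
theorem le_mul_mul_log {k : ℕ} (hk : 2 ≤ k) {ε : ℝ} (hε0 : 0 < ε) (hε1 : ε < 1) :
    (k : ℝ) ≤ 10 ^ 17 * ε⁻¹ ^ 5 * k * Real.log k := by
  have hL := half_le_log hk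
  have hε : 1 ≤ ε⁻¹ ^ 5 := one_le_pow₀ ((one_le_inv₀ hε0).mpr hε1.le)
  have h1 : 1 / 2 * 1 ≤ Real.log k * ε⁻¹ ^ 5 := by gcongr
  have h2 : (1 : ℝ) ≤ 10 ^ 17 * (Real.log k * ε⁻¹ ^ 5) := by linarith
  calc (k : ℝ) = k * 1 := (mul_one _).symm
    _ ≤ k * (10 ^ 17 * (Real.log k * ε⁻¹ ^ 5)) := by gcongr
    _ = _ := by ring

theorem mainTheorem4 :
    ∃ (c γ : ℝ → ℝ) (c' : ℝ),
      0 < c' ∧ (∀ ε : ℝ, 0 < ε → ε < 1 → 0 < c ε ∧ 0 < γ ε) ∧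
      PolyInInv c ∧ PolyInInv (fun ε => (γ ε)⁻¹) ∧
      ∀ (ε : ℝ), 0 < ε → ε < 1 →
      ∀ (d : ℕ), 1 ≤ d →
      ∀ (n : Fin (d + 1) → ℕ) (m : ℕ), (∀ i, 1 ≤ n i) →
        (∀ i : Fin d, c ε * (n i.castSucc : ℝ) * Real.log (n i.castSucc : ℝ) ≤ (n i.succ : ℝ)) →
        c ε * (d : ℝ) * (n 0 : ℝ) * Real.log (∏ i : Fin d, (n i.succ : ℝ)) < (m : ℝ) →
      ∀ (Ω : Type*) [MeasurableSpace Ω] (μ : Measure Ω) [IsProbabilityMeasure μ]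
        (W : (i : Fin d) → Ω → Matrix (Fin (n i.succ)) (Fin (n i.castSucc)) ℝ)
        (A : Ω → Matrix (Fin m) (Fin (n (Fin.last d))) ℝ),
        (∀ i : Fin d, IIDGaussianEntries (W i) ((n i.succ : ℝ≥0)⁻¹) μ) →
        IIDGaussianEntries A ((m : ℝ≥0)⁻¹) μ →
        IndepFun (fun ω (i : Fin d) (j : Fin (n i.succ)) (l : Fin (n i.castSucc)) => W i ω j l)
          (fun ω (j : Fin m) (l : Fin (n (Fin.last d))) => A ω j l) μ →
        ∃ E : Set Ω, MeasurableSet E ∧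
          1 - ∑ i : Fin d, c' * (n i.succ : ℝ) * Real.exp (-(γ ε) * (n i.castSucc : ℝ))
              - c' * Real.exp (-(γ ε) * (m : ℝ)) ≤ μ.real E ∧
          ∀ ω ∈ E, (∀ i : Fin d, WDC (W i ω) ε) ∧ RRIC (A ω) (network (fun i => W i ω)) ε := by
  -- `c` and the factor `5` come from the WDC, and this `c` dominates the `256000 ε⁻²` needed for
  -- the RRIC. The rate `γ` comes from the RRIC and is below the rate `1` of the WDC.
  refine ⟨fun ε => 10 ^ 17 * ε⁻¹ ^ 5, fun ε => ε ^ 2 / 6400, 5, by norm_num,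
    fun ε h0 _ => ⟨by positivity, by positivity⟩,
    polyInInv_const_mul_pow (by norm_num) (by norm_num), ?_, ?_⟩
  · convert polyInInv_const_mul_pow (C := 6400) (p := 2) (by norm_num) (by norm_num) using 2 with ε
    rw [inv_div, inv_pow, div_eq_mul_inv]
  intro ε hε0 hε1 d hd n m hn1 hn hm Ω _ μ _ W A hW hA hWA
  have hγ : ε ^ 2 / 6400 ≤ 1 := by nlinarith
  have hterm : ∀ i : Fin d,
      0 ≤ 5 * (n i.succ : ℝ) * Real.exp (-(ε ^ 2 / 6400) * (n i.castSucc : ℝ)) := fun i => by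
    positivity
  -- When an input width is `1`, its logarithm is zero and the width condition says nothing; but
  -- then the claimed probability is not positive, since `5 e^{-γ} ≥ 5 / e > 1`, and the empty event
  -- suffices.
  by_cases htriv : ∃ i : Fin d, n i.castSucc = 1
  · obtain ⟨i, hi⟩ := htriv
    refine ⟨∅, MeasurableSet.empty, ?_, by simp⟩
    have h1 := Finset.single_le_sum (fun j _ => hterm j) (Finset.mem_univ i)
    have h2 : (1 : ℝ) ≤ 5 * (n i.succ : ℝ) * Real.exp (-(ε ^ 2 / 6400) * (n i.castSucc : ℝ)) := by
      have h3 : (1 : ℝ) ≤ n i.succ := by exact_mod_cast hn1 i.succ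
      have h4 : Real.exp (-1) ≤ Real.exp (-(ε ^ 2 / 6400) * (n i.castSucc : ℝ)) := by
        rw [hi]
        gcongr
        push_cast
        linarith
      have h5 : (1 : ℝ) ≤ 5 * Real.exp (-1) := by linarith [Real.exp_neg_one_gt_d9]
      nlinarith
    have h6 : 0 ≤ 5 * Real.exp (-(ε ^ 2 / 6400) * (m : ℝ)) := by positivity
    rw [measureReal_empty]
    linarith
  · push Not at htriv
    have hn2 : ∀ i : Fin d, 2 ≤ n i.castSucc := fun i => by
      have := hn1 i.castSucc
      have := htriv i
      omega
    have hmono : ∀ i : Fin d, n i.castSucc ≤ n i.succ := fun i => by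
      exact_mod_cast (le_mul_mul_log (hn2 i) hε0 hε1).trans (hn i)
    have hns : ∀ i : Fin d, 2 ≤ n i.succ := fun i => (hn2 i).trans (hmono i)
    let i₀ : Fin d := ⟨0, hd⟩
    have hprod : n 0 ≤ ∏ j : Fin d, n j.succ :=
      (hmono i₀).trans (Finset.single_le_prod' (f := fun j : Fin d => n j.succ)
        (fun j _ => hn1 j.succ) (Finset.mem_univ i₀))
    have hprod2 : 2 ≤ ∏ j : Fin d, n j.succ := (hn2 i₀).trans hprod
    have hlog : 0 ≤ Real.log (∏ j : Fin d, (n j.succ : ℝ)) := by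
      apply Real.log_nonneg
      have h1 : 1 ≤ ∏ j : Fin d, n j.succ := by omega
      exact_mod_cast h1
    have hm' : 256000 * ε⁻¹ ^ 2 * n 0 * Real.log (∏ j : Fin d, (n j.succ : ℝ)) < m := by
      refine lt_of_le_of_lt ?_ hm
      have hd' : (1 : ℝ) ≤ d := by exact_mod_cast hd
      have hε : ε⁻¹ ^ 2 ≤ ε⁻¹ ^ 5 :=
        pow_le_pow_right₀ ((one_le_inv₀ hε0).mpr hε1.le) (by norm_num)
      have h1 : 256000 * ε⁻¹ ^ 2 ≤ 10 ^ 17 * ε⁻¹ ^ 5 * d := by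
        calc 256000 * ε⁻¹ ^ 2 ≤ 10 ^ 17 * ε⁻¹ ^ 5 := by
              gcongr
              norm_num
          _ ≤ _ := le_mul_of_one_le_right (by positivity) hd'
      gcongr
    have hm0 : 0 < m := by
      have : (0 : ℝ) < m := lt_of_le_of_lt (by positivity) hm'
      exact_mod_cast this
    have hRRIC := measureReal_not_RRIC_network_le hW hm0 hA hWA (by positivity)
      (pi_stdGaussian_real_not_RRIC_network_le (hn1 0) hns hprod hprod2 hε0 hε1 hm')
    have hWDC : ∀ i : Fin d, μ.real {ω | ¬ WDC (W i ω) ε} ≤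
        5 * (n i.succ : ℝ) * Real.exp (-(ε ^ 2 / 6400) * (n i.castSucc : ℝ)) := by
      intro i
      refine ((hW i).measureReal_le (hn1 i.succ) fun M => ¬ WDC M ε).trans
        ((pi_stdGaussian_real_not_WDC_le (hn2 i) hε0 hε1 (hn i)).trans ?_)
      gcongr
      have : (0 : ℝ) ≤ n i.castSucc := by positivity
      nlinarith
    rw [sub_sub]
    refine exists_measurableSet_of_measureReal_le ?_
    have hsub : {ω | ¬ ((∀ i : Fin d, WDC (W i ω) ε) ∧ RRIC (A ω) (network fun i => W i ω) ε)} ⊆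
        (⋃ i : Fin d, {ω | ¬ WDC (W i ω) ε}) ∪
          {ω | ¬ RRIC (A ω) (network fun i => W i ω) ε} := by
      intro ω hω
      simp only [Set.mem_union, Set.mem_iUnion, Set.mem_ofPred_eq] at hω ⊢
      rw [not_and_or, not_forall] at hω
      exact hω
    calc _ ≤ _ := measureReal_mono hsub
      _ ≤ _ := measureReal_union_le _ _
      _ ≤ _ := add_le_add ((measureReal_iUnion_fintype_le _).trans
          (Finset.sum_le_sum fun i _ => hWDC i)) (hRRIC.trans (by gcongr; norm_num))
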